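/- **Theorem (an upper bound).** Let $N\ge 1$, $l_1,\dots,l_N\ge 1$ be integers, $d=l_1+\cdots+l_N$, and let $\Omega=B_{l_1}\times\cdots\times B_{l_N}\subset\mathbb C^d$, where $B_l$ is the open unit ball of $\mathbb C^l$ for the hermitian norm. (This covers the ball, $N=1$; the product of two balls, $N=2$; and the polydisk, $N=d$, $l_1=\cdots=l_N=1$.) Thus $\Omega$ is the open unit ball of $\mathbb C^d$ for the norm $|||z|||=\max_{1\le i\le N}\|z^{(i)}\|_2$, where $z=(z^{(1)},\dots,z^{(N)})$ with $z^{(i)}\in\mathbb C^{l_i}$. Let $\sigma=\sigma_{l_1}\otimes\cdots\otimes\sigma_{l_N}$ be the product of the normalized area measures on the unit spheres $S_{l_i}$ of $\mathbb C^{l_i}$, a probability measure on $S_\Omega=S_{l_1}\times\cdots\times S_{l_N}$, and let $H^2(\Omega)$ be the Hardy space of all holomorphic $f:\Omega\to\mathbb C$ with $$\|f\|_{H^2(\Omega)}=\Big(\sup_{0<r<1}\int_{S_\Omega}|f(r\xi)|^2\,d\sigma(\xi)\Big)^{1/2}<\infty .$$ Let $\phi:\Omega\to\Omega$ be a non-constant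 holomorphic map whose differential $\phi'(a):\mathbb C^d\to\mathbb C^d$ is invertible for at least one $a\in\Omega$, and suppose that $C_\phi f=f\circ\phi$ defines a compact operator $C_\phi:H^2(\Omega)\to H^2(\Omega)$. For a bounded operator $T$ on $H^2(\Omega)$ and $n\ge1$ let $a_n(T)=\inf\{\|T-R\| : R \text{ bounded on } H^2(\Omega),\ \operatorname{rank}R<n\}$, and let $$\gamma_d^-(T)=\liminf_{n\to\infty}\frac{\log (1/a_n(T))}{n^{1/d}}\in[-\infty,+\infty],\qquad \log(1/0)=+\infty .$$ If $\|\phi\|_\infty:=\sup_{z\in\Omega}|||\phi(z)|||<1$, then $\gamma_d^-(C_\phi)>0$; that is, there are constants $0<c\le C<\infty$, independent of $n$, such that $$a_n(C_\phi)\le C\,e^{-c\,n^{1/d}},\qquad n=1,2,\dots$$ -/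

import Mathlib

open Set Filter Topology MeasureTheory
open scoped ENNReal

noncomputable section

/-- `ℂ^d = ℂ^{l_1} × ⋯ × ℂ^{l_N}` with `d = l_1 + ⋯ + l_N`. Each factor carries its hermitian norm
and the product carries the maximum of these norms, i.e. the norm `|||z|||`. -/
abbrev PolySpace {N : ℕ} (l : Fin N → ℕ) : Type := (i : Fin N) → EuclideanSpace ℂ (Fin (l i))

/-- The product of unit balls `Ω = B_{l_1} × ⋯ × B_{l_N}`, i.e. the open unit ball of `|||·|||`. -/
def polyBall {N : ℕ} (l : Fin N → ℕ) : Set (PolySpace l) := {z | ∀ i, ‖z i‖ < 1}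

/-- The Shilov boundary `S_Ω = S_{l_1} × ⋯ × S_{l_N}`, as a type. -/
abbrev ShilovBoundary {N : ℕ} (l : Fin N → ℕ) : Type :=
  (i : Fin N) → Metric.sphere (0 : EuclideanSpace ℂ (Fin (l i))) 1

/-- The normalized area measure on the hermitian unit sphere of `ℂ^k` (`k ≥ 1`). -/
def sphereMeasure (k : ℕ) : Measure (Metric.sphere (0 : EuclideanSpace ℂ (Fin k)) 1) :=
  ((volume : Measure (EuclideanSpace ℂ (Fin k))).toSphere univ)⁻¹ •
    (volume : Measure (EuclideanSpace ℂ (Fin k))).toSphere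

/-- The invariant probability measure `σ = σ_{l_1} ⊗ ⋯ ⊗ σ_{l_N}` on the Shilov boundary. -/
def shilovMeasure {N : ℕ} (l : Fin N → ℕ) : Measure (ShilovBoundary l) :=
  Measure.pi fun i => sphereMeasure (l i)

/-- The point `r ξ`, for `ξ` in the Shilov boundary. -/
def dilate {N : ℕ} {l : Fin N → ℕ} (r : ℝ) (ξ : ShilovBoundary l) : PolySpace l :=
  fun i => r • (ξ i : EuclideanSpace ℂ (Fin (l i)))

/-- `(sup_{0 < r < 1} ∫_{S_Ω} |f (r ξ)|² dσ(ξ))^{1/2}`, possibly infinite. -/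
def hardyENorm {N : ℕ} (l : Fin N → ℕ) (f : PolySpace l → ℂ) : ℝ≥0∞ :=
  (⨆ r ∈ Ioo (0 : ℝ) 1, ∫⁻ ξ, ‖f (dilate r ξ)‖ₑ ^ 2 ∂(shilovMeasure l)) ^ (1 / 2 : ℝ)

theorem isOpen_polyBall {N : ℕ} (l : Fin N → ℕ) : IsOpen (polyBall l) := by
  have : polyBall l = ⋂ i, {z : PolySpace l | ‖z i‖ < 1} := by
    ext z; simp [polyBall]
  rw [this]
  exact isOpen_iInter_of_finite fun i =>
    isOpen_lt (continuous_apply i).norm continuous_const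

theorem continuous_dilate {N : ℕ} {l : Fin N → ℕ} (r : ℝ) :
    Continuous (dilate (l := l) r) :=
  continuous_pi fun i => (continuous_subtype_val.comp (continuous_apply i)).const_smul r

theorem norm_dilate {N : ℕ} {l : Fin N → ℕ} {r : ℝ} (hr : r ∈ Ioo (0 : ℝ) 1)
    (ξ : ShilovBoundary l) (i : Fin N) : ‖dilate r ξ i‖ = r := by
  have h : ‖(ξ i : EuclideanSpace ℂ (Fin (l i)))‖ = 1 := by
    simp
  simp [dilate, norm_smul, h, abs_of_pos hr.1]

theorem dilate_mem {N : ℕ} {l : Fin N → ℕ} {r : ℝ} (hr : r ∈ Ioo (0 : ℝ) 1)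
    (ξ : ShilovBoundary l) : dilate r ξ ∈ polyBall l := fun i => by
  rw [norm_dilate hr]; exact hr.2

theorem continuous_comp_dilate {N : ℕ} {l : Fin N → ℕ} {f : PolySpace l → ℂ}
    (hf : DifferentiableOn ℂ f (polyBall l)) {r : ℝ} (hr : r ∈ Ioo (0 : ℝ) 1) :
    Continuous fun ξ : ShilovBoundary l => f (dilate r ξ) :=
  hf.continuousOn.comp_continuous (continuous_dilate r) (dilate_mem hr)

theorem hardyENorm_eq {N : ℕ} (l : Fin N → ℕ) (f : PolySpace l → ℂ) :
    hardyENorm l f = ⨆ r ∈ Ioo (0 : ℝ) 1,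
      eLpNorm (fun ξ : ShilovBoundary l => f (dilate r ξ)) 2 (shilovMeasure l) := by
  have key : ∀ r : ℝ, eLpNorm (fun ξ : ShilovBoundary l => f (dilate r ξ)) 2 (shilovMeasure l) =
      (∫⁻ ξ, ‖f (dilate r ξ)‖ₑ ^ 2 ∂(shilovMeasure l)) ^ (1 / 2 : ℝ) := fun r => by
    rw [eLpNorm_eq_lintegral_rpow_enorm_toReal (by norm_num) (by norm_num)]
    simp
  simp only [key]
  have h := (ENNReal.orderIsoRpow (1 / 2 : ℝ) (by norm_num)).map_iSup₂
    (fun (r : ℝ) (_ : r ∈ Ioo (0 : ℝ) 1) => ∫⁻ ξ, ‖f (dilate r ξ)‖ₑ ^ 2 ∂(shilovMeasure l))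
  exact h

theorem hardyENorm_add_le {N : ℕ} {l : Fin N → ℕ} {f g : PolySpace l → ℂ}
    (hf : DifferentiableOn ℂ f (polyBall l)) (hg : DifferentiableOn ℂ g (polyBall l)) :
    hardyENorm l (f + g) ≤ hardyENorm l f + hardyENorm l g := by
  simp only [hardyENorm_eq]
  refine iSup₂_le fun r hr => ?_
  refine (eLpNorm_add_le (continuous_comp_dilate hf hr).aestronglyMeasurable
    (continuous_comp_dilate hg hr).aestronglyMeasurable (by norm_num)).trans ?_
  exact add_le_add
    (le_iSup₂ (f := fun (r : ℝ) (_ : r ∈ Ioo (0 : ℝ) 1) =>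
      eLpNorm (fun ξ : ShilovBoundary l => f (dilate r ξ)) 2 (shilovMeasure l)) r hr)
    (le_iSup₂ (f := fun (r : ℝ) (_ : r ∈ Ioo (0 : ℝ) 1) =>
      eLpNorm (fun ξ : ShilovBoundary l => g (dilate r ξ)) 2 (shilovMeasure l)) r hr)

theorem hardyENorm_smul {N : ℕ} {l : Fin N → ℕ} (c : ℂ) (f : PolySpace l → ℂ) :
    hardyENorm l (c • f) = ‖c‖ₑ * hardyENorm l f := by
  simp only [hardyENorm_eq, ENNReal.mul_iSup]
  refine iSup_congr fun r => iSup_congr fun _ => ?_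
  exact eLpNorm_const_smul c (fun ξ : ShilovBoundary l => f (dilate r ξ)) 2 (shilovMeasure l)

theorem hardyENorm_zero {N : ℕ} (l : Fin N → ℕ) : hardyENorm l 0 = 0 := by
  have := hardyENorm_smul (0 : ℂ) (0 : PolySpace l → ℂ)
  simpa using this

/-- The functions `f` holomorphic on `Ω` with `‖f‖_{H²(Ω)} < ∞`. A function on `Ω` is represented
by its extension by `0` to the whole space, so that distinct elements differ on `Ω`. -/
def hardySubmodule {N : ℕ} (l : Fin N → ℕ) : Submodule ℂ (PolySpace l → ℂ) where
  carrier := {f | DifferentiableOn ℂ f (polyBall l) ∧ (∀ z, z ∉ polyBall l → f z = 0) ∧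
    hardyENorm l f < ∞}
  zero_mem' := ⟨differentiableOn_const 0, fun _ _ => rfl, by simp [hardyENorm_zero]⟩
  add_mem' := fun {f g} hf hg => ⟨hf.1.add hg.1,
    fun z hz => by simp [hf.2.1 z hz, hg.2.1 z hz],
    (hardyENorm_add_le hf.1 hg.1).trans_lt (ENNReal.add_lt_top.2 ⟨hf.2.2, hg.2.2⟩)⟩
  smul_mem' := fun c f hf => ⟨hf.1.const_smul c, fun z hz => by simp [hf.2.1 z hz], by
    rw [hardyENorm_smul]; exact ENNReal.mul_lt_top enorm_lt_top hf.2.2⟩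

/-- The Hardy space `H²(Ω)`. (A type of its own, so that it carries the topology of the Hardy norm
and not the one of pointwise convergence.) -/
def Hardy {N : ℕ} (l : Fin N → ℕ) : Type := hardySubmodule l

instance {N : ℕ} (l : Fin N → ℕ) : AddCommGroup (Hardy l) :=
  inferInstanceAs (AddCommGroup (hardySubmodule l))

instance {N : ℕ} (l : Fin N → ℕ) : Module ℂ (Hardy l) :=
  inferInstanceAs (Module ℂ (hardySubmodule l))

/-- The function underlying an element of `H²(Ω)`. -/
def Hardy.toFun {N : ℕ} {l : Fin N → ℕ} (f : Hardy l) : PolySpace l → ℂ := f.1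

instance {N : ℕ} (l : Fin N → ℕ) : CoeFun (Hardy l) (fun _ => PolySpace l → ℂ) := ⟨Hardy.toFun⟩

instance {N : ℕ} (l : Fin N → ℕ) : Norm (Hardy l) := ⟨fun f => (hardyENorm l f).toReal⟩

instance (k : ℕ) [NeZero k] : Nontrivial (EuclideanSpace ℂ (Fin k)) :=
  inferInstance

theorem sphereMeasure_univ_ne_zero (k : ℕ) [NeZero k] :
    (volume : Measure (EuclideanSpace ℂ (Fin k))).toSphere univ ≠ 0 := by
  rw [Ne, Measure.measure_univ_eq_zero]
  exact Measure.toSphere_ne_zero _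

instance (k : ℕ) [NeZero k] : IsProbabilityMeasure (sphereMeasure k) := ⟨by
  rw [sphereMeasure, Measure.smul_apply, smul_eq_mul]
  exact ENNReal.inv_mul_cancel (sphereMeasure_univ_ne_zero k) (measure_ne_top _ _)⟩

instance (k : ℕ) [NeZero k] : (sphereMeasure k).IsOpenPosMeasure :=
  Measure.isOpenPosMeasure_smul _ (ENNReal.inv_ne_zero.2 (measure_ne_top _ _))

instance {N : ℕ} (l : Fin N → ℕ) [∀ i, NeZero (l i)] : IsProbabilityMeasure (shilovMeasure l) := by
  unfold shilovMeasure; infer_instance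

instance {N : ℕ} (l : Fin N → ℕ) [∀ i, NeZero (l i)] : (shilovMeasure l).IsOpenPosMeasure := by
  unfold shilovMeasure; infer_instance

theorem eq_zero_of_norm_eq {N : ℕ} {l : Fin N → ℕ} [∀ i, NeZero (l i)] {f : PolySpace l → ℂ}
    (hf : DifferentiableOn ℂ f (polyBall l)) {r : ℝ} (hr : r ∈ Ioo (0 : ℝ) 1)
    (h0 : ∀ z : PolySpace l, (∀ i, ‖z i‖ = r) → f z = 0) (s : Finset (Fin N)) :
    ∀ z : PolySpace l, (∀ i ∈ s, ‖z i‖ ≤ r) → (∀ i ∉ s, ‖z i‖ = r) → f z = 0 := by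
  classical
  induction s using Finset.induction_on with
  | empty => intro z _ hz; exact h0 z fun i => hz i (by simp)
  | insert j s hj ih =>
    intro z hz hz'
    have hle : ∀ i, ‖z i‖ ≤ r := fun i => by
      by_cases hi : i ∈ insert j s
      · exact hz i hi
      · exact (hz' i hi).le
    have hmem : ∀ x ∈ Metric.ball (0 : EuclideanSpace ℂ (Fin (l j))) 1,
        Function.update z j x ∈ polyBall l := by
      intro x hx i
      by_cases hi : i = j
      · subst hi; simpa using hx
      · simpa [hi] using (hle i).trans_lt hr.2
    have hd : DifferentiableOn ℂ (fun x => f (Function.update z j x))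
        (Metric.ball (0 : EuclideanSpace ℂ (Fin (l j))) 1) :=
      hf.comp (fun x _ => (hasFDerivAt_update z x).differentiableAt.differentiableWithinAt) hmem
    have hd' : DiffContOnCl ℂ (fun x => f (Function.update z j x))
        (Metric.ball (0 : EuclideanSpace ℂ (Fin (l j))) r) := by
      refine DifferentiableOn.diffContOnCl (hd.mono ?_)
      rw [closure_ball _ hr.1.ne']
      exact Metric.closedBall_subset_ball hr.2
    have key := Complex.norm_le_of_forall_mem_frontier_norm_le Metric.isBounded_ball hd'
      (C := 0) (z := z j) ?_ ?_
    · simpa using key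
    · intro x hx
      rw [frontier_ball _ hr.1.ne'] at hx
      have hx' : ‖x‖ = r := by simpa using hx
      rw [ih (Function.update z j x), norm_zero]
      · intro i hi
        have hij : i ≠ j := fun h => hj (h ▸ hi)
        simpa [hij] using hle i
      · intro i hi
        by_cases hij : i = j
        · subst hij; simpa using hx'
        · simpa [hij] using hz' i (by simp [hij, hi])
    · rw [closure_ball _ hr.1.ne']
      simpa using hle j

theorem eq_zero_of_hardyENorm_eq_zero {N : ℕ} {l : Fin N → ℕ} [∀ i, NeZero (l i)]
    {f : PolySpace l → ℂ} (hf : DifferentiableOn ℂ f (polyBall l)) (h : hardyENorm l f = 0)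
    (z : PolySpace l) (hz : z ∈ polyBall l) : f z = 0 := by
  obtain ⟨r, hr, hzr⟩ : ∃ r ∈ Ioo (0 : ℝ) 1, ∀ i, ‖z i‖ ≤ r := by
    have hz1 : ‖z‖ < 1 := (pi_norm_lt_iff one_pos).2 hz
    obtain ⟨r, h1, h2⟩ := exists_between hz1
    exact ⟨r, ⟨(norm_nonneg z).trans_lt h1, h2⟩, fun i => (norm_le_pi_norm z i).trans h1.le⟩
  have hc := continuous_comp_dilate hf hr
  have hae : eLpNorm (fun ξ : ShilovBoundary l => f (dilate r ξ)) 2 (shilovMeasure l) = 0 := by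
    rw [hardyENorm_eq] at h
    simp only [ENNReal.iSup_eq_zero] at h
    exact h r hr
  rw [eLpNorm_eq_zero_iff hc.aestronglyMeasurable (by norm_num)] at hae
  have hzero := Measure.eq_of_ae_eq hae hc continuous_const
  refine eq_zero_of_norm_eq hf hr (fun w hw => ?_) Finset.univ z (fun i _ => hzr i) (by simp)
  have := congrFun hzero fun i => (⟨r⁻¹ • w i, by
    simp [norm_smul, hw i, abs_of_pos hr.1, hr.1.ne']⟩ :
      Metric.sphere (0 : EuclideanSpace ℂ (Fin (l i))) 1)
  have he : dilate r (fun i => (⟨r⁻¹ • w i, by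
    simp [norm_smul, hw i, abs_of_pos hr.1, hr.1.ne']⟩ :
      Metric.sphere (0 : EuclideanSpace ℂ (Fin (l i))) 1)) = w := by
    funext i
    simp [dilate, smul_smul, hr.1.ne']
  simpa [he] using this

theorem Hardy.core {N : ℕ} (l : Fin N → ℕ) [∀ i, NeZero (l i)] :
    NormedSpace.Core ℂ (Hardy l) where
  norm_nonneg f := ENNReal.toReal_nonneg
  norm_smul c f := by
    change (hardyENorm l (c • f.1)).toReal = ‖c‖ * (hardyENorm l f.1).toReal
    rw [hardyENorm_smul, ENNReal.toReal_mul, toReal_enorm]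
  norm_triangle f g := by
    change (hardyENorm l (f.1 + g.1)).toReal ≤ (hardyENorm l f.1).toReal + (hardyENorm l g.1).toReal
    rw [← ENNReal.toReal_add f.2.2.2.ne g.2.2.2.ne]
    exact ENNReal.toReal_mono (ENNReal.add_lt_top.2 ⟨f.2.2.2, g.2.2.2⟩).ne
      (hardyENorm_add_le f.2.1 g.2.1)
  norm_eq_zero_iff f := by
    constructor
    · intro h
      have h0 : hardyENorm l f.1 = 0 :=
        ((ENNReal.toReal_eq_zero_iff _).1 h).resolve_right f.2.2.2.ne
      refine Subtype.ext (funext fun z => ?_)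
      by_cases hz : z ∈ polyBall l
      · exact eq_zero_of_hardyENorm_eq_zero f.2.1 h0 z hz
      · exact f.2.2.1 z hz
    · rintro rfl
      change (hardyENorm l 0).toReal = 0
      simp [hardyENorm_zero]

instance {N : ℕ} (l : Fin N → ℕ) [∀ i, NeZero (l i)] : NormedAddCommGroup (Hardy l) :=
  NormedAddCommGroup.ofCore (Hardy.core l)

instance {N : ℕ} (l : Fin N → ℕ) [∀ i, NeZero (l i)] : NormedSpace ℂ (Hardy l) :=
  NormedSpace.ofCore (Hardy.core l)

/-- A Schur map of `Ω`: a non-constant analytic self-map of `Ω`. -/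
structure IsSchurMap {N : ℕ} (l : Fin N → ℕ) (φ : PolySpace l → PolySpace l) : Prop where
  differentiableOn : DifferentiableOn ℂ φ (polyBall l)
  mapsTo : MapsTo φ (polyBall l) (polyBall l)
  nonconstant : ∃ z ∈ polyBall l, ∃ w ∈ polyBall l, φ z ≠ φ w

/-- `φ` is truly `d`-dimensional: `φ'(a)` is invertible for at least one `a ∈ Ω`. -/
def IsTrulyDimensional {N : ℕ} (l : Fin N → ℕ) (φ : PolySpace l → PolySpace l) : Prop :=
  ∃ a ∈ polyBall l, (fderiv ℂ φ a).IsInvertible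

/-- `‖φ‖_∞ = sup_{z ∈ Ω} |||φ(z)|||` (a bounded set of reals for a self-map of `Ω`). -/
def supNorm {N : ℕ} (l : Fin N → ℕ) (φ : PolySpace l → PolySpace l) : ℝ :=
  sSup ((fun z => ‖φ z‖) '' polyBall l)

/-- The bounded operator `T` on `H²(Ω)` is the composition operator `C_φ : f ↦ f ∘ φ`. -/
def IsCompositionOperator {N : ℕ} (l : Fin N → ℕ) [∀ i, NeZero (l i)]
    (φ : PolySpace l → PolySpace l) (T : Hardy l →L[ℂ] Hardy l) : Prop :=
  ∀ f : Hardy l, ∀ z ∈ polyBall l, T f z = f (φ z)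

/-- The approximation numbers `a_n(T) = inf {‖T - R‖ : rank R < n}`, for `n ≥ 1`. -/
def approxNumber {H : Type*} [NormedAddCommGroup H] [NormedSpace ℂ H] (T : H →L[ℂ] H) (n : ℕ) : ℝ :=
  sInf {x : ℝ | ∃ R : H →L[ℂ] H, R.toLinearMap.rank < (n : Cardinal) ∧ x = ‖T - R‖}

/-- `γ_d^-(T) = liminf_{n → ∞} log (1 / a_n(T)) / n^{1/d}`, with `log (1 / 0) = ∞`. -/
def gammaMinus {H : Type*} [NormedAddCommGroup H] [NormedSpace ℂ H] (d : ℕ) (T : H →L[ℂ] H) :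
    EReal :=
  liminf (fun n : ℕ => ENNReal.log ((ENNReal.ofReal (approxNumber T n))⁻¹) /
    (((n : ℝ) ^ (1 / (d : ℝ)) : ℝ) : EReal)) atTop

end

/-! Let `ρ < 1` bound `|||φ|||` on `Ω`, fix `ρ < r < 1`, and put `q = ρ / r`. Point evaluations on
`|||z||| ≤ r` are bounded by `C‖f‖`, so every `f` in `H²` is bounded there. Cauchy's estimates on
complex lines through the origin then show that the Taylor polynomial `p_K` of degree `< K`
satisfies `|f - p_K| ≤ C‖f‖ q^K / (1 - q)` on `|||w||| ≤ ρ`. At `w = φ(z)` this holds for all `z ∈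
Ω`. Since `σ` is a probability measure, the sup norm dominates the Hardy norm, so `f ↦ p_K ∘ φ` is
within `O(q^K)` of `C_φ`. Its rank is at most `K^d`, and `K` just below `n^{1/d}` gives the claim
(`exists_finiteRank_approx`, `approxNumber_le_exp`).

Two ingredients need work. Boundedness of evaluations (`Hardy.exists_norm_apply_le`) comes from
Cauchy's formula on complex lines combined with invariance of the measures under unimodular scalars,
one ball factor at a time. Finite rank needs the homogeneous Taylor terms to be polynomials
(`iteratedDeriv_slice_mem_homogPoly`), an induction resting on the holomorphy of directional
derivatives. -/

noncomputable section

/-! ### Pointwise bounds by sphere integrals in one ball -/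

section

open scoped Pointwise

/-- Cauchy's formula bounds a holomorphic function on a smaller disc by an integral over the
boundary circle. -/
theorem enorm_le_lintegral_circleMap {F : ℂ → ℂ} {r s : ℝ} (hsr : s < r) (hs : 0 ≤ s)
    (hF : DiffContOnCl ℂ F (Metric.ball 0 r)) {w : ℂ} (hw : ‖w‖ ≤ s) :
    ‖F w‖ₑ ≤ ENNReal.ofReal (r / (r - s)) *
      ∫⁻ θ in Ioc 0 (2 * Real.pi), ‖F (circleMap 0 r θ)‖ₑ := by
  have hr : 0 < r := hs.trans_lt hsr
  have hF' : DiffContOnCl ℂ F (Metric.ball 0 |r|) := by rwa [abs_of_pos hr]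
  have hw' : w ∈ Metric.ball (0 : ℂ) |r| := by
    rw [abs_of_pos hr]; simpa using hw.trans_lt hsr
  rw [← hF'.circleAverage_smul_div hw', Real.circleAverage_def, enorm_smul]
  -- The normalization `1 / (2π)` is simply discarded; only finiteness of the constants matters.
  have h1 : ‖((2 * Real.pi)⁻¹ : ℝ)‖ₑ ≤ 1 := by
    rw [Real.enorm_eq_ofReal (by positivity), ENNReal.ofReal_le_one]
    exact inv_le_one_of_one_le₀ (by linarith [Real.pi_gt_three])
  refine (mul_le_mul_left h1 _).trans ?_
  rw [one_mul, intervalIntegral.integral_of_le (by positivity)]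
  refine (enorm_integral_le_lintegral_enorm _).trans ?_
  rw [← lintegral_const_mul' _ _ ENNReal.ofReal_ne_top]
  refine lintegral_mono fun θ => ?_
  rw [enorm_smul]
  refine mul_le_mul_left ?_ _
  rw [← ofReal_norm]
  refine ENNReal.ofReal_le_ofReal ?_
  rw [norm_div, sub_zero, norm_circleMap_zero, abs_of_pos hr]
  have h2 : r - s ≤ ‖circleMap 0 r θ - w‖ := by
    have := norm_sub_norm_le (circleMap 0 r θ) w
    rw [norm_circleMap_zero, abs_of_pos hr] at this
    linarith
  have : 0 < r - s := by linarith
  gcongr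

/-- Multiplication by a unimodular number, as a real isometry of `ℂ^k`. -/
def rotationIso {k : ℕ} (c : Circle) :
    EuclideanSpace ℂ (Fin k) ≃ₗᵢ[ℝ] EuclideanSpace ℂ (Fin k) where
  toFun v := (c : ℂ) • v
  invFun v := (c⁻¹ : ℂ) • v
  map_add' := smul_add _
  map_smul' a v := smul_comm _ _ _
  left_inv v := by simp [smul_smul]
  right_inv v := by simp [smul_smul]
  norm_map' v := by
    change ‖(c : ℂ) • v‖ = ‖v‖
    rw [norm_smul, Circle.norm_coe, one_mul]

theorem measurePreserving_smul_circle {k : ℕ} (c : Circle) :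
    MeasurePreserving (fun v : EuclideanSpace ℂ (Fin k) => (c : ℂ) • v) volume volume :=
  (rotationIso c).measurePreserving

/-- Multiplication by a unimodular number on the unit sphere of `ℂ^k`. -/
def sphereRotation {k : ℕ} (c : Circle) (ξ : Metric.sphere (0 : EuclideanSpace ℂ (Fin k)) 1) :
    Metric.sphere (0 : EuclideanSpace ℂ (Fin k)) 1 :=
  ⟨(c : ℂ) • (ξ : EuclideanSpace ℂ (Fin k)), by
    rw [mem_sphere_zero_iff_norm, norm_smul, Circle.norm_coe, one_mul, norm_eq_of_mem_sphere]⟩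

theorem continuous_sphereRotation {k : ℕ} (c : Circle) :
    Continuous (sphereRotation (k := k) c) :=
  (continuous_subtype_val.const_smul (c : ℂ)).subtype_mk _

/-- The surface measure of a set is a multiple of the volume of the cone over it, and the rotation
carries cones to cones as a linear isometry. -/
theorem measurePreserving_sphereRotation {k : ℕ} (c : Circle) :
    MeasurePreserving (sphereRotation (k := k) c)
      (volume : Measure (EuclideanSpace ℂ (Fin k))).toSphere
      (volume : Measure (EuclideanSpace ℂ (Fin k))).toSphere := by
  refine ⟨(continuous_sphereRotation c).measurable, Measure.ext fun s hs => ?_⟩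
  rw [Measure.map_apply (continuous_sphereRotation c).measurable hs,
    Measure.toSphere_apply' _ hs,
    Measure.toSphere_apply' _ ((continuous_sphereRotation c).measurable hs)]
  congr 1
  have h : Ioo (0 : ℝ) 1 • (Subtype.val '' (sphereRotation (k := k) c ⁻¹' s)) =
      rotationIso c ⁻¹' (Ioo (0 : ℝ) 1 • (Subtype.val '' s)) := by
    ext v
    simp only [Set.mem_smul, mem_preimage, mem_image]
    constructor
    · rintro ⟨t, ht, _, ⟨ξ, hξ, rfl⟩, rfl⟩
      exact ⟨t, ht, _, ⟨_, hξ, rfl⟩, ((rotationIso c).map_smul t _).symm⟩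
    · rintro ⟨t, ht, _, ⟨ξ, hξ, rfl⟩, hv⟩
      have hξ' : sphereRotation c (sphereRotation c⁻¹ ξ) = ξ := by
        ext1
        simp [sphereRotation, smul_smul]
      refine ⟨t, ht, _, ⟨sphereRotation c⁻¹ ξ, by rwa [hξ'], rfl⟩, ?_⟩
      apply (rotationIso c).injective
      rw [← hv, (rotationIso c).map_smul]
      congr 1
      exact congrArg Subtype.val hξ'
  rw [h]
  exact (rotationIso c).measurePreserving.measure_preimage_emb
    (rotationIso c).toHomeomorph.measurableEmbedding _

/-- The sphere integral is placed inside, so that an estimate at each fixed radius can be integrated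
over the radii. -/
theorem lintegral_volume_eq_polar {k : ℕ} [NeZero k] {G : EuclideanSpace ℂ (Fin k) → ℝ≥0∞}
    (hG : Measurable G) :
    ∫⁻ v, G v = ∫⁻ t : Ioi (0 : ℝ), ∫⁻ ξ,
      G ((t : ℝ) • (ξ : EuclideanSpace ℂ (Fin k)))
        ∂(volume : Measure (EuclideanSpace ℂ (Fin k))).toSphere
        ∂(Measure.volumeIoiPow (Module.finrank ℝ (EuclideanSpace ℂ (Fin k)) - 1)) := by
  have hmp := (volume : Measure (EuclideanSpace ℂ (Fin k))).measurePreserving_homeomorphUnitSphereProd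
  have hc : Continuous fun p : Metric.sphere (0 : EuclideanSpace ℂ (Fin k)) 1 × Ioi (0 : ℝ) =>
      (p.2 : ℝ) • (p.1 : EuclideanSpace ℂ (Fin k)) := by fun_prop
  have hm : Measurable fun p : Metric.sphere (0 : EuclideanSpace ℂ (Fin k)) 1 × Ioi (0 : ℝ) =>
      G ((p.2 : ℝ) • (p.1 : EuclideanSpace ℂ (Fin k))) := hG.comp hc.measurable
  rw [← lintegral_prod_symm _ hm.aemeasurable, ← hmp.lintegral_comp hm]
  have h0 : ∫⁻ v, G v = ∫⁻ v in ({0}ᶜ : Set (EuclideanSpace ℂ (Fin k))), G v := by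
    rw [restrict_compl_singleton]
  rw [h0, ← lintegral_subtype_comap (measurableSet_singleton _).compl]
  refine lintegral_congr fun v => ?_
  congr 1
  have : (v : EuclideanSpace ℂ (Fin k)) ≠ 0 := v.2
  simp [homeomorphUnitSphereProd, smul_smul, this]

theorem circleMap_zero_one_eq (θ : ℝ) : circleMap 0 1 θ = (Circle.exp θ : ℂ) := by
  simp [circleMap, Circle.coe_exp]

/-- Sub-mean value property over a ball. -/
theorem volume_ball_mul_enorm_le {k : ℕ} {F : EuclideanSpace ℂ (Fin k) → ℂ} (hm : Measurable F)
    (hF : DifferentiableOn ℂ F (Metric.ball 0 1)) {w : EuclideanSpace ℂ (Fin k)} {δ : ℝ}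
    (hw : ‖w‖ + δ ≤ 1) :
    volume (Metric.ball (0 : EuclideanSpace ℂ (Fin k)) δ) * ‖F w‖ₑ ≤
      ENNReal.ofReal (2 * Real.pi) * ∫⁻ v in Metric.ball w δ, ‖F v‖ₑ := by
  set B := Metric.ball (0 : EuclideanSpace ℂ (Fin k)) δ with hB
  -- Recentred at `w` and extended by zero, the integrand lives on the whole space, where
  -- translations and rotations preserve volume.
  set G : EuclideanSpace ℂ (Fin k) → ℝ≥0∞ := B.indicator fun v => ‖F (w + v)‖ₑ with hG
  have hGm : Measurable G :=
    ((hm.comp (measurable_const_add w)).enorm).indicator Metric.isOpen_ball.measurableSet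
  have hGi : ∫⁻ v, G v = ∫⁻ v in Metric.ball w δ, ‖F v‖ₑ := by
    rw [← lintegral_indicator Metric.isOpen_ball.measurableSet,
      ← lintegral_add_left_eq_self
        (fun v => (Metric.ball w δ).indicator (fun v => ‖F v‖ₑ) v) w]
    refine lintegral_congr fun v => ?_
    simp [hG, hB, indicator, Metric.mem_ball, dist_eq_norm]
  rw [← hGi]
  -- Cauchy's formula at the centre of the disc `ζ ↦ w + ζ • v`, `‖ζ‖ ≤ 1`.
  have key : ∀ v ∈ B, ‖F w‖ₑ ≤
      ∫⁻ θ in Ioc 0 (2 * Real.pi), G ((Circle.exp θ : ℂ) • v) := by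
    intro v hv
    have hv' : ‖v‖ < δ := by simpa [hB] using hv
    have hd : DiffContOnCl ℂ (fun ζ : ℂ => F (w + ζ • v)) (Metric.ball 0 1) := by
      apply DifferentiableOn.diffContOnCl
      rw [closure_ball _ one_ne_zero]
      refine hF.comp (by fun_prop) fun ζ hζ => ?_
      have hζ' : ‖ζ‖ ≤ 1 := by simpa using hζ
      have : ‖w + ζ • v‖ ≤ ‖w‖ + ‖v‖ := (norm_add_le _ _).trans (by
        rw [norm_smul]; gcongr; exact mul_le_of_le_one_left (norm_nonneg _) hζ')
      rw [mem_ball_zero_iff]; linarith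
    have := enorm_le_lintegral_circleMap one_pos le_rfl hd (w := 0) (by simp)
    simp only [zero_smul, add_zero, sub_zero, div_one, ENNReal.ofReal_one, one_mul] at this
    refine this.trans (lintegral_mono fun θ => ?_)
    have hmem : (Circle.exp θ : ℂ) • v ∈ B := by simpa [hB, norm_smul] using hv'
    simp only [hG, indicator_of_mem hmem, circleMap_zero_one_eq, le_refl]
  calc volume B * ‖F w‖ₑ = ∫⁻ _ in B, ‖F w‖ₑ := by rw [setLIntegral_const, mul_comm]
    _ ≤ ∫⁻ v in B, ∫⁻ θ in Ioc 0 (2 * Real.pi), G ((Circle.exp θ : ℂ) • v) :=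
      setLIntegral_mono' Metric.isOpen_ball.measurableSet key
    _ ≤ ∫⁻ v, ∫⁻ θ in Ioc 0 (2 * Real.pi), G ((Circle.exp θ : ℂ) • v) :=
      setLIntegral_le_lintegral _ _
    _ = ∫⁻ θ in Ioc 0 (2 * Real.pi), ∫⁻ v, G ((Circle.exp θ : ℂ) • v) := by
      refine lintegral_lintegral_swap (hGm.comp ?_).aemeasurable
      exact Continuous.measurable (by fun_prop)
    _ = ∫⁻ θ in Ioc 0 (2 * Real.pi), ∫⁻ v, G v := by
      refine lintegral_congr fun θ => ?_
      exact (measurePreserving_smul_circle (Circle.exp θ)).lintegral_comp hGm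
    _ = _ := by
      rw [setLIntegral_const, Real.volume_Ioc, sub_zero, mul_comm]

/-- Cauchy's formula on the complex line through `ξ` bounds the value at `t • ξ` by a circle
integral of radius `r`. Integrated over `ξ`, each rotation drops out by invariance, and the circle
contributes only `2π`. The constant does not depend on `t ≤ s`. -/
theorem lintegral_sphere_smul_le {k : ℕ} {F : EuclideanSpace ℂ (Fin k) → ℂ}
    (hm : Measurable F) (hF : DifferentiableOn ℂ F (Metric.ball 0 1)) {r s t : ℝ}
    (hr : r < 1) (hs : 0 ≤ s) (hsr : s < r) (ht : 0 ≤ t) (hts : t ≤ s) :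
    ∫⁻ ξ : Metric.sphere (0 : EuclideanSpace ℂ (Fin k)) 1,
        ‖F (t • (ξ : EuclideanSpace ℂ (Fin k)))‖ₑ
        ∂(volume : Measure (EuclideanSpace ℂ (Fin k))).toSphere ≤
      ENNReal.ofReal (r / (r - s)) * (ENNReal.ofReal (2 * Real.pi) *
        ∫⁻ ξ : Metric.sphere (0 : EuclideanSpace ℂ (Fin k)) 1,
          ‖F (r • (ξ : EuclideanSpace ℂ (Fin k)))‖ₑ
          ∂(volume : Measure (EuclideanSpace ℂ (Fin k))).toSphere) := by
  have hr0 : 0 < r := hs.trans_lt hsr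
  set H : Metric.sphere (0 : EuclideanSpace ℂ (Fin k)) 1 → ℝ≥0∞ :=
    fun ξ => ‖F (r • (ξ : EuclideanSpace ℂ (Fin k)))‖ₑ with hH
  have hHm : Measurable H :=
    (hm.comp (Continuous.measurable (by fun_prop))).enorm
  have key : ∀ ξ : Metric.sphere (0 : EuclideanSpace ℂ (Fin k)) 1,
      ‖F (t • (ξ : EuclideanSpace ℂ (Fin k)))‖ₑ ≤ ENNReal.ofReal (r / (r - s)) *
        ∫⁻ θ in Ioc 0 (2 * Real.pi), H (sphereRotation (Circle.exp θ) ξ) := by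
    intro ξ
    have hξ : ‖(ξ : EuclideanSpace ℂ (Fin k))‖ = 1 := by simp
    have hd : DiffContOnCl ℂ (fun ζ : ℂ => F (ζ • (ξ : EuclideanSpace ℂ (Fin k))))
        (Metric.ball 0 r) := by
      apply DifferentiableOn.diffContOnCl
      rw [closure_ball _ hr0.ne']
      refine hF.comp (by fun_prop) fun ζ hζ => ?_
      have hζ' : ‖ζ‖ ≤ r := by simpa using hζ
      rw [mem_ball_zero_iff, norm_smul, hξ, mul_one]
      exact hζ'.trans_lt hr
    have := enorm_le_lintegral_circleMap hsr hs hd (w := (t : ℂ)) (by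
      rwa [Complex.norm_real, Real.norm_of_nonneg ht])
    simp only [Complex.coe_smul] at this
    refine this.trans_eq ?_
    congr 1
    refine lintegral_congr fun θ => ?_
    simp only [hH, sphereRotation, ← Complex.coe_smul, smul_smul]
    simp [circleMap, Circle.coe_exp]
  refine (lintegral_mono key).trans ?_
  rw [lintegral_const_mul' _ _ ENNReal.ofReal_ne_top]
  refine mul_le_mul_right (le_of_eq ?_) _
  rw [lintegral_lintegral_swap]
  · have : ∀ θ : ℝ, ∫⁻ ξ, H (sphereRotation (Circle.exp θ) ξ)
        ∂(volume : Measure (EuclideanSpace ℂ (Fin k))).toSphere = ∫⁻ ξ, H ξ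
        ∂(volume : Measure (EuclideanSpace ℂ (Fin k))).toSphere := fun θ =>
      (measurePreserving_sphereRotation (Circle.exp θ)).lintegral_comp hHm
    simp only [this]
    rw [setLIntegral_const, Real.volume_Ioc, sub_zero, mul_comm]
  · refine (hHm.comp ?_).aemeasurable
    refine Continuous.measurable ?_
    unfold sphereRotation
    fun_prop

/-- With `ρ < s < r`, the ball of radius `s - ρ` about `w` lies in the ball of radius `s` about `0`.
The sub-mean value property bounds `F w` by the volume integral over the latter, and polar
coordinates bound that by the integral over the sphere of radius `r`. -/
theorem exists_enorm_le_lintegral_sphere (k : ℕ) [NeZero k] {ρ r : ℝ} (hρ : 0 ≤ ρ) (hρr : ρ < r)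
    (hr : r < 1) : ∃ C : ℝ≥0∞, C ≠ ∞ ∧ ∀ F : EuclideanSpace ℂ (Fin k) → ℂ, Measurable F →
      DifferentiableOn ℂ F (Metric.ball 0 1) → ∀ w, ‖w‖ ≤ ρ →
      ‖F w‖ₑ ≤ C * ∫⁻ ξ : Metric.sphere (0 : EuclideanSpace ℂ (Fin k)) 1,
        ‖F (r • (ξ : EuclideanSpace ℂ (Fin k)))‖ₑ ∂sphereMeasure k := by
  obtain ⟨s, hρs, hsr⟩ := exists_between hρr
  have hs : 0 < s := hρ.trans_lt hρs
  set V := volume (Metric.ball (0 : EuclideanSpace ℂ (Fin k)) (s - ρ)) with hV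
  have hV0 : V ≠ 0 := (Metric.measure_ball_pos _ _ (by linarith)).ne'
  have hVt : V ≠ ∞ := measure_ball_lt_top.ne
  set A := (volume : Measure (EuclideanSpace ℂ (Fin k))).toSphere univ with hA
  have hA0 : A ≠ 0 := sphereMeasure_univ_ne_zero k
  have hAt : A ≠ ∞ := measure_ne_top _ _
  set p : ℝ≥0∞ := ENNReal.ofReal (2 * Real.pi)
  set c : ℝ≥0∞ := ENNReal.ofReal (r / (r - s))
  set m := Measure.volumeIoiPow (Module.finrank ℝ (EuclideanSpace ℂ (Fin k)) - 1)
  set D : ℝ≥0∞ := m (Iio (⟨s, hs⟩ : Ioi (0 : ℝ)))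
  have hD : D ≠ ∞ := by
    simp only [D, m, Measure.volumeIoiPow_apply_Iio]; exact ENNReal.ofReal_ne_top
  refine ⟨V⁻¹ * (p * (D * (c * (p * A)))), ?_, ?_⟩
  · have hp : p ≠ ∞ := ENNReal.ofReal_ne_top
    have hc : c ≠ ∞ := ENNReal.ofReal_ne_top
    finiteness
  intro F hm hF w hw
  set I := ∫⁻ ξ : Metric.sphere (0 : EuclideanSpace ℂ (Fin k)) 1,
    ‖F (r • (ξ : EuclideanSpace ℂ (Fin k)))‖ₑ
      ∂(volume : Measure (EuclideanSpace ℂ (Fin k))).toSphere with hI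
  have hσ : ∫⁻ ξ : Metric.sphere (0 : EuclideanSpace ℂ (Fin k)) 1,
      ‖F (r • (ξ : EuclideanSpace ℂ (Fin k)))‖ₑ ∂sphereMeasure k = A⁻¹ * I := by
    rw [sphereMeasure, lintegral_smul_measure, smul_eq_mul]
  have hball : ∫⁻ v in Metric.ball (0 : EuclideanSpace ℂ (Fin k)) s, ‖F v‖ₑ ≤
      D * (c * (p * I)) := by
    rw [← lintegral_indicator Metric.isOpen_ball.measurableSet,
      lintegral_volume_eq_polar (hm.enorm.indicator Metric.isOpen_ball.measurableSet)]
    -- Radii `t ≥ s` contribute nothing; the others have total radial mass `D` and share one bound.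
    calc _ ≤ ∫⁻ t, (Iio (⟨s, hs⟩ : Ioi (0 : ℝ))).indicator (fun _ => c * (p * I)) t ∂m := by
          refine lintegral_mono fun t => ?_
          have ht0 : 0 < (t : ℝ) := t.2
          by_cases ht : (t : ℝ) < s
          · rw [indicator_of_mem (show t ∈ Iio (⟨s, hs⟩ : Ioi (0 : ℝ)) from ht)]
            refine le_trans (lintegral_mono fun ξ => indicator_le_self _ _ _) ?_
            exact lintegral_sphere_smul_le hm hF hr hs.le hsr ht0.le ht.le
          · refine le_of_eq_of_le ?_ zero_le
            rw [lintegral_eq_zero_iff']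
            · refine Eventually.of_forall fun ξ => ?_
              refine indicator_of_notMem ?_ _
              simpa [norm_smul, abs_of_pos ht0] using ht
            · exact ((hm.enorm.indicator Metric.isOpen_ball.measurableSet).comp
                (Continuous.measurable (by fun_prop))).aemeasurable
      _ = D * (c * (p * I)) := by
          rw [lintegral_indicator measurableSet_Iio, setLIntegral_const, mul_comm]
  have hsub := volume_ball_mul_enorm_le hm hF (w := w) (δ := s - ρ) (by linarith)
  have hmono : ∫⁻ v in Metric.ball w (s - ρ), ‖F v‖ₑ ≤
      ∫⁻ v in Metric.ball (0 : EuclideanSpace ℂ (Fin k)) s, ‖F v‖ₑ := by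
    refine lintegral_mono_set (Metric.ball_subset_ball' ?_)
    rw [dist_zero_right]; linarith
  have h1 : V * ‖F w‖ₑ ≤ p * (D * (c * (p * I))) :=
    hsub.trans (mul_le_mul_right (hmono.trans hball) _)
  rw [hσ]
  calc ‖F w‖ₑ = V⁻¹ * (V * ‖F w‖ₑ) := by
        rw [← mul_assoc, ENNReal.inv_mul_cancel hV0 hVt, one_mul]
    _ ≤ V⁻¹ * (p * (D * (c * (p * I)))) := mul_le_mul_right h1 _
    _ = V⁻¹ * (p * (D * (c * (p * (A * A⁻¹ * I))))) := by
        rw [ENNReal.mul_inv_cancel hA0 hAt, one_mul]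
    _ = _ := by ring

end

/-! ### Products of balls and bounded point evaluations -/

/-- The normalized area measure of the sphere of radius `r`, as a measure on `ℂ^k`. -/
def scaledSphereMeasure (k : ℕ) (r : ℝ) : Measure (EuclideanSpace ℂ (Fin k)) :=
  (sphereMeasure k).map fun ξ : Metric.sphere (0 : EuclideanSpace ℂ (Fin k)) 1 =>
    r • (ξ : EuclideanSpace ℂ (Fin k))

theorem measurable_smul_sphere {k : ℕ} (r : ℝ) :
    Measurable fun ξ : Metric.sphere (0 : EuclideanSpace ℂ (Fin k)) 1 =>
      r • (ξ : EuclideanSpace ℂ (Fin k)) :=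
  Continuous.measurable (by fun_prop)

instance (k : ℕ) [NeZero k] (r : ℝ) : IsProbabilityMeasure (scaledSphereMeasure k r) :=
  Measure.isProbabilityMeasure_map (measurable_smul_sphere r).aemeasurable

theorem lintegral_scaledSphereMeasure {k : ℕ} {r : ℝ} {G : EuclideanSpace ℂ (Fin k) → ℝ≥0∞}
    (hG : Measurable G) : ∫⁻ v, G v ∂scaledSphereMeasure k r =
      ∫⁻ ξ, G (r • (ξ : EuclideanSpace ℂ (Fin k))) ∂sphereMeasure k :=
  lintegral_map hG (measurable_smul_sphere r)

theorem ae_norm_eq_scaledSphereMeasure {k : ℕ} {r : ℝ} (hr : 0 ≤ r) :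
    ∀ᵐ v ∂scaledSphereMeasure k r, ‖v‖ = r := by
  rw [scaledSphereMeasure, ae_map_iff (measurable_smul_sphere r).aemeasurable
    (measurableSet_eq_fun measurable_norm measurable_const)]
  exact Eventually.of_forall fun ξ => by simp [norm_smul, abs_of_nonneg hr]

/-- Moving the measure from the Shilov boundary to the ambient space allows functions of `z` to be
integrated one factor at a time with `lmarginal`. -/
theorem map_dilate_shilovMeasure {N : ℕ} (l : Fin N → ℕ) [∀ i, NeZero (l i)] (r : ℝ) :
    (shilovMeasure l).map (dilate r) = Measure.pi fun i => scaledSphereMeasure (l i) r := by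
  have (i : Fin N) : IsProbabilityMeasure ((sphereMeasure (l i)).map
      fun ξ : Metric.sphere (0 : EuclideanSpace ℂ (Fin (l i))) 1 =>
        r • (ξ : EuclideanSpace ℂ (Fin (l i)))) :=
    inferInstanceAs (IsProbabilityMeasure (scaledSphereMeasure (l i) r))
  exact Measure.pi_map_pi (μ := fun i => sphereMeasure (l i))
    (f := fun i (ξ : Metric.sphere (0 : EuclideanSpace ℂ (Fin (l i))) 1) => r • (ξ : EuclideanSpace ℂ (Fin (l i))))
    fun i => (measurable_smul_sphere r).aemeasurable

theorem measurable_of_zero_off_polyBall {N : ℕ} {l : Fin N → ℕ} {f : PolySpace l → ℂ}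
    (hf : DifferentiableOn ℂ f (polyBall l)) (h0 : ∀ z, z ∉ polyBall l → f z = 0) :
    Measurable f := by
  classical
  have hpw : f = (polyBall l).piecewise f fun _ => 0 := by
    funext z
    by_cases hz : z ∈ polyBall l
    · rw [piecewise_eq_of_mem _ _ _ hz]
    · rw [piecewise_eq_of_notMem _ _ _ hz, h0 z hz]
  rw [hpw]
  exact hf.continuousOn.measurable_piecewise continuousOn_const (isOpen_polyBall l).measurableSet

/-- The one-ball estimate is applied to each factor in turn with the other factors frozen, so the
constants multiply. -/
theorem exists_enorm_le_lintegral_shilov {N : ℕ} (l : Fin N → ℕ) [∀ i, NeZero (l i)] {ρ r : ℝ}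
    (hρ : 0 ≤ ρ) (hρr : ρ < r) (hr : r < 1) : ∃ C : ℝ≥0∞, C ≠ ∞ ∧ ∀ F : PolySpace l → ℂ,
      Measurable F → DifferentiableOn ℂ F (polyBall l) → ∀ z, (∀ i, ‖z i‖ ≤ ρ) →
      ‖F z‖ₑ ≤ C * ∫⁻ ξ, ‖F (dilate r ξ)‖ₑ ∂shilovMeasure l := by
  choose C hC hCF using fun i => exists_enorm_le_lintegral_sphere (l i) hρ hρr hr
  refine ⟨∏ i, C i, ENNReal.prod_ne_top fun i _ => hC i, fun F hm hF z hz => ?_⟩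
  set μ : (i : Fin N) → Measure (EuclideanSpace ℂ (Fin (l i))) :=
    fun i => scaledSphereMeasure (l i) r with hμ
  -- Off `s` only `‖z i‖ < 1` is asked, because factors already replaced sit on the sphere of radius
  -- `r > ρ`.
  have key : ∀ s : Finset (Fin N), ∀ z : PolySpace l, (∀ i ∈ s, ‖z i‖ ≤ ρ) →
      (∀ i ∉ s, ‖z i‖ < 1) →
      ‖F z‖ₑ ≤ (∏ i ∈ s, C i) * (∫⋯∫⁻_s, (fun z => ‖F z‖ₑ) ∂μ) z := by
    intro s
    induction s using Finset.induction_on with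
    | empty => intro z _ _; simp
    | insert j s hj ih =>
      intro z hz hz'
      have hlt : ∀ i, ‖z i‖ < 1 := fun i => by
        by_cases hi : i ∈ insert j s
        · exact (hz i hi).trans_lt (hρr.trans hr)
        · exact hz' i hi
      have hd : DifferentiableOn ℂ (fun x => F (Function.update z j x)) (Metric.ball 0 1) := by
        refine hF.comp
          (fun x _ => (hasFDerivAt_update z x).differentiableAt.differentiableWithinAt) ?_
        intro x hx i
        by_cases hi : i = j
        · subst hi; simpa using hx
        · simpa [hi] using hlt i
      have h1 := hCF j (fun x => F (Function.update z j x))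
        (hm.comp (measurable_update z)) hd (z j) (hz j (Finset.mem_insert_self _ _))
      rw [Function.update_eq_self] at h1
      have h2 : ∫⁻ ξ : Metric.sphere (0 : EuclideanSpace ℂ (Fin (l j))) 1,
          ‖F (Function.update z j (r • (ξ : EuclideanSpace ℂ (Fin (l j)))))‖ₑ
            ∂sphereMeasure (l j) = ∫⁻ x, ‖F (Function.update z j x)‖ₑ ∂μ j :=
        (lintegral_scaledSphereMeasure
          (G := fun x => ‖F (Function.update z j x)‖ₑ)
          (hm.comp (measurable_update z)).enorm).symm
      rw [h2] at h1
      refine h1.trans ?_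
      rw [Finset.prod_insert hj, mul_assoc, lmarginal_insert _ hm.enorm hj,
        ← lintegral_const_mul' _ _ (ENNReal.prod_ne_top fun i _ => hC i)]
      -- The induction hypothesis needs `‖x‖ < 1`, which holds only almost everywhere: the measure
      -- is carried by `‖x‖ = r`.
      refine mul_le_mul_right (lintegral_mono_ae ?_) _
      filter_upwards [ae_norm_eq_scaledSphereMeasure (k := l j) (hρ.trans hρr.le)] with x hx
      refine ih _ (fun i hi => ?_) fun i hi => ?_
      · have hij : i ≠ j := fun h => hj (h ▸ hi)
        simpa [hij] using hz i (Finset.mem_insert_of_mem hi)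
      · by_cases hij : i = j
        · subst hij; simpa [hx] using hr
        · simpa [hij] using hlt i
  have := key Finset.univ z (fun i _ => hz i) (by simp)
  rwa [lmarginal_univ, ← map_dilate_shilovMeasure, lintegral_map hm.enorm
    (continuous_dilate r).measurable] at this

theorem Hardy.differentiableOn {N : ℕ} {l : Fin N → ℕ} (f : Hardy l) :
    DifferentiableOn ℂ f (polyBall l) := f.2.1

/-- Point evaluations are bounded on `H²(Ω)`, uniformly on compact subsets of `Ω`. -/
theorem Hardy.exists_norm_apply_le {N : ℕ} (l : Fin N → ℕ) [∀ i, NeZero (l i)] {ρ : ℝ}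
    (hρ : 0 ≤ ρ) (hρ1 : ρ < 1) : ∃ C : ℝ, 0 ≤ C ∧ ∀ f : Hardy l, ∀ z : PolySpace l,
      (∀ i, ‖z i‖ ≤ ρ) → ‖f z‖ ≤ C * ‖f‖ := by
  obtain ⟨r, hρr, hr⟩ := exists_between hρ1
  obtain ⟨C, hC, hCF⟩ := exists_enorm_le_lintegral_shilov l hρ hρr hr
  refine ⟨(C ^ (1 / 2 : ℝ)).toReal, ENNReal.toReal_nonneg, fun f z hz => ?_⟩
  have hm : Measurable f := measurable_of_zero_off_polyBall f.2.1 f.2.2.1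
  -- Applying the `L¹` estimate to the holomorphic function `f ^ 2` yields the `L²` estimate after a
  -- square root.
  have h1 := hCF (fun z => f z ^ 2) (hm.pow_const 2) (f.differentiableOn.pow 2) z hz
  simp only [enorm_pow] at h1
  have h2 : ∫⁻ ξ, ‖f (dilate r ξ)‖ₑ ^ 2 ∂shilovMeasure l ≤
      ⨆ r ∈ Ioo (0 : ℝ) 1, ∫⁻ ξ, ‖f (dilate r ξ)‖ₑ ^ 2 ∂shilovMeasure l :=
    le_iSup₂ (f := fun (r : ℝ) (_ : r ∈ Ioo (0 : ℝ) 1) =>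
      ∫⁻ ξ, ‖f (dilate r ξ)‖ₑ ^ 2 ∂shilovMeasure l) r ⟨hρ.trans_lt hρr, hr⟩
  have h3 : ‖f z‖ₑ ≤ C ^ (1 / 2 : ℝ) * hardyENorm l f := by
    have := ENNReal.rpow_le_rpow (h1.trans (mul_le_mul_right h2 _))
      (show (0 : ℝ) ≤ 1 / 2 by norm_num)
    rw [ENNReal.mul_rpow_of_nonneg _ _ (by norm_num), ← ENNReal.rpow_natCast,
      ← ENNReal.rpow_mul] at this
    simpa [hardyENorm] using this
  have hCt : C ^ (1 / 2 : ℝ) ≠ ∞ := ENNReal.rpow_ne_top_of_nonneg (by norm_num) hC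
  have h4 := ENNReal.toReal_mono (ENNReal.mul_ne_top hCt f.2.2.2.ne) h3
  rwa [toReal_enorm, ENNReal.toReal_mul] at h4

/-- The Hardy norm is dominated by the supremum norm. -/
theorem hardyENorm_le_of_forall_norm_le {N : ℕ} {l : Fin N → ℕ} [∀ i, NeZero (l i)]
    {g : PolySpace l → ℂ} {M : ℝ} (hg : ∀ z ∈ polyBall l, ‖g z‖ ≤ M) :
    hardyENorm l g ≤ ENNReal.ofReal M := by
  rw [hardyENorm_eq]
  refine iSup₂_le fun r hr => ?_
  refine (eLpNorm_le_of_ae_bound (C := M) (Eventually.of_forall fun ξ =>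
    hg _ (dilate_mem hr ξ))).trans ?_
  simp

/-! ### Holomorphy of directional derivatives -/

/-- Directional derivatives of a holomorphic function of several variables are holomorphic. -/
theorem differentiableOn_fderiv_apply_const {E : Type*} [NormedAddCommGroup E] [NormedSpace ℂ E]
    [FiniteDimensional ℂ E] [MeasurableSpace E] [BorelSpace E] {f : E → ℂ} {U : Set E}
    (hU : IsOpen U) (hf : DifferentiableOn ℂ f U) (v : E) :
    DifferentiableOn ℂ (fun z => fderiv ℂ f z v) U := by
  have := FiniteDimensional.proper ℂ E
  have := FiniteDimensional.proper ℂ (E →L[ℂ] ℂ)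
  intro z₀ hz₀
  refine DifferentiableAt.differentiableWithinAt ?_
  -- One `ε` for moving `z`, one for the shift `ζ • v`, one for the Cauchy estimate of the
  -- derivative.
  obtain ⟨ε, hε, hεU⟩ : ∃ ε > 0, Metric.closedBall z₀ (3 * ε) ⊆ U := by
    obtain ⟨ε, hε, h⟩ := Metric.nhds_basis_closedBall.mem_iff.1 (hU.mem_nhds hz₀)
    exact ⟨ε / 3, by positivity, by rwa [mul_div_cancel₀ _ (by norm_num)]⟩
  obtain ⟨M, hM⟩ := (isCompact_closedBall z₀ (3 * ε)).exists_bound_of_continuousOn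
    (hf.continuousOn.mono hεU)
  have hM0 : 0 ≤ M := (norm_nonneg _).trans
    (hM z₀ (Metric.mem_closedBall_self (by positivity)))
  set δ : ℝ := ε / (‖v‖ + 1) with hδ
  have hδ0 : 0 < δ := by positivity
  have hδv : δ * ‖v‖ ≤ ε := by
    rw [hδ, div_mul_eq_mul_div, div_le_iff₀ (by positivity)]
    nlinarith [norm_nonneg v]
  have hshift : ∀ z ∈ Metric.ball z₀ ε, ∀ ζ : ℂ, ‖ζ‖ ≤ δ →
      z + ζ • v ∈ Metric.closedBall z₀ (2 * ε) := by
    intro z hz ζ hζ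
    rw [mem_closedBall_iff_norm]
    rw [mem_ball_iff_norm] at hz
    have h1 : ‖ζ • v‖ ≤ ε := by
      rw [norm_smul]; exact (mul_le_mul_of_nonneg_right hζ (norm_nonneg v)).trans hδv
    calc ‖z + ζ • v - z₀‖ = ‖(z - z₀) + ζ • v‖ := by congr 1; abel
      _ ≤ ‖z - z₀‖ + ‖ζ • v‖ := norm_add_le _ _
      _ ≤ 2 * ε := by linarith
  have h23 : Metric.closedBall z₀ (2 * ε) ⊆ U :=
    (Metric.closedBall_subset_closedBall (by linarith)).trans hεU
  have hder : ∀ y ∈ Metric.closedBall z₀ (2 * ε), ‖fderiv ℂ f y‖ ≤ 2 * M / ε := by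
    intro y hy
    have hsub : Metric.ball y ε ⊆ Metric.closedBall z₀ (3 * ε) := by
      refine Metric.ball_subset_closedBall.trans (Metric.closedBall_subset_closedBall' ?_)
      rw [Metric.mem_closedBall] at hy; linarith
    refine Complex.norm_fderiv_le_div_of_mapsTo_ball (hf.mono (hsub.trans hεU)) ?_ hε
    intro x hx
    rw [mem_closedBall_iff_norm]
    refine (norm_sub_le _ _).trans ?_
    have := hM x (hsub hx)
    have := hM y (hsub (Metric.mem_ball_self hε))
    linarith
  set c : ℝ → ℂ := fun θ => deriv (circleMap 0 δ) θ * ((circleMap 0 δ θ - 0) ^ 2)⁻¹ with hc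
  have hcn : ∀ θ, ‖c θ‖ = δ⁻¹ := by
    intro θ
    simp [hc, abs_of_pos hδ0]
    field_simp
  have hcc : Continuous c := by
    simp only [hc, deriv_circleMap]
    refine (by fun_prop : Continuous fun θ => circleMap 0 δ θ * Complex.I).mul
      (Continuous.inv₀ (by fun_prop) fun θ => ?_)
    simpa using hδ0.ne'
  have hcm : ∀ θ, ‖circleMap 0 δ θ‖ ≤ δ := fun θ => by simp [abs_of_pos hδ0]
  -- Cauchy's formula for the derivative along `v` involves only values of `f`, so it can be
  -- differentiated in `z` under the integral, with `hder` providing the domination.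
  have heq : ∀ z ∈ Metric.ball z₀ ε, fderiv ℂ f z v = (2 * Real.pi * Complex.I : ℂ)⁻¹ •
      ∫ θ in (0 : ℝ)..2 * Real.pi, c θ • f (z + circleMap 0 δ θ • v) := by
    intro z hz
    have hzU : z ∈ U := by
      have := hshift z hz 0 (by simpa using hδ0.le)
      rw [zero_smul, add_zero] at this
      exact h23 this
    set V : Set ℂ := (fun ζ : ℂ => z + ζ • v) ⁻¹' U
    have hV : IsOpen V := hU.preimage (by fun_prop)
    have hd : DifferentiableOn ℂ (fun ζ : ℂ => f (z + ζ • v)) V :=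
      hf.comp (by fun_prop) fun ζ hζ => hζ
    have h1 := Complex.cderiv_eq_deriv hV hd hδ0 (z := 0) fun ζ hζ =>
      h23 (hshift z hz ζ (by simpa using hζ))
    have h2 : HasDerivAt (fun ζ : ℂ => f (z + ζ • v)) (fderiv ℂ f z v) 0 := by
      have hfz : HasFDerivAt f (fderiv ℂ f z) (z + (0 : ℂ) • v) := by
        rw [zero_smul, add_zero]
        exact (hf.differentiableAt (hU.mem_nhds hzU)).hasFDerivAt
      have hl : HasDerivAt (fun ζ : ℂ => z + ζ • v) v 0 := by
        simpa using ((hasDerivAt_id (0 : ℂ)).smul_const v).const_add z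
      exact hfz.comp_hasDerivAt 0 hl
    rw [← h2.deriv, ← h1, Complex.cderiv, circleIntegral]
    congr 1
    refine intervalIntegral.integral_congr fun θ _ => ?_
    simp only [hc, smul_eq_mul, mul_assoc]
  have hmain := intervalIntegral.hasFDerivAt_integral_of_dominated_of_fderiv_le (𝕜 := ℂ)
    (μ := volume) (a := 0) (b := 2 * Real.pi) (s := Metric.ball z₀ ε) (x₀ := z₀)
    (F := fun z θ => c θ • f (z + circleMap 0 δ θ • v))
    (F' := fun z θ => c θ • fderiv ℂ f (z + circleMap 0 δ θ • v))
    (bound := fun _ => δ⁻¹ * (2 * M / ε)) (Metric.ball_mem_nhds _ hε)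
    ?_ ?_ ?_ ?_ ?_ ?_
  · refine (hmain.differentiableAt.const_smul (2 * Real.pi * Complex.I : ℂ)⁻¹).congr_of_eventuallyEq ?_
    filter_upwards [Metric.ball_mem_nhds z₀ hε] with z hz using heq z hz
  · filter_upwards [Metric.ball_mem_nhds z₀ hε] with z hz
    refine Continuous.aestronglyMeasurable (hcc.smul ?_)
    exact hf.continuousOn.comp_continuous (by fun_prop) fun θ => h23 (hshift z hz _ (hcm θ))
  · refine Continuous.intervalIntegrable (hcc.smul ?_) _ _
    exact hf.continuousOn.comp_continuous (by fun_prop) fun θ =>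
      h23 (hshift z₀ (Metric.mem_ball_self hε) _ (hcm θ))
  · refine (hcc.aestronglyMeasurable).smul ?_
    -- Measurability of the derivative suffices here; its continuity is not needed.
    refine Measurable.aestronglyMeasurable ((measurable_fderiv ℂ f).comp ?_)
    exact Continuous.measurable (by fun_prop)
  · refine Eventually.of_forall fun θ _ z hz => ?_
    rw [norm_smul, hcn]
    gcongr
    exact hder _ (hshift z hz _ (hcm θ))
  · exact intervalIntegrable_const
  · refine Eventually.of_forall fun θ _ z hz => ?_
    have hfz := (hf.differentiableAt
      (hU.mem_nhds (h23 (hshift z hz _ (hcm θ))))).hasFDerivAt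
    exact ((hasFDerivAt_comp_add_right _).2 hfz).const_smul (c θ)

/-! ### Homogeneous terms of the Taylor expansion -/

/-- The monomial `z ↦ z^α`. -/
def polyMonomial {N : ℕ} {l : Fin N → ℕ} (α : (Σ i, Fin (l i)) → ℕ) (z : PolySpace l) : ℂ :=
  ∏ j, z j.1 j.2 ^ α j

/-- The homogeneous polynomials of degree `m`. -/
def homogPoly {N : ℕ} (l : Fin N → ℕ) (m : ℕ) : Submodule ℂ (PolySpace l → ℂ) :=
  Submodule.span ℂ {p | ∃ α : (Σ i, Fin (l i)) → ℕ, ∑ j, α j = m ∧ p = polyMonomial α}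

theorem coord_mul_mem_homogPoly {N : ℕ} {l : Fin N → ℕ} {m : ℕ} {p : PolySpace l → ℂ}
    (hp : p ∈ homogPoly l m) (j : Σ i, Fin (l i)) :
    (fun z => z j.1 j.2 * p z) ∈ homogPoly l (m + 1) := by
  classical
  let L : (PolySpace l → ℂ) →ₗ[ℂ] (PolySpace l → ℂ) :=
    LinearMap.mulLeft ℂ (fun z : PolySpace l => (z j.1 j.2 : ℂ))
  change L p ∈ _
  refine (Submodule.span_le (p := (homogPoly l (m + 1)).comap L)).2 ?_ hp
  rintro _ ⟨α, hα, rfl⟩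
  refine Submodule.subset_span ⟨α + Pi.single j 1, ?_, ?_⟩
  · simp [Finset.sum_add_distrib, hα]
  · funext z
    simp only [L, LinearMap.mulLeft_apply, Pi.mul_apply, polyMonomial, Pi.add_apply, pow_add,
      Finset.prod_mul_distrib]
    rw [mul_comm]
    congr 1
    rw [Finset.prod_eq_single j] <;> simp +contextual

/-- The standard basis vectors of `ℂ^{l_1} × ⋯ × ℂ^{l_N}`. -/
def polyBasis {N : ℕ} (l : Fin N → ℕ) (j : Σ i, Fin (l i)) : PolySpace l :=
  Pi.single j.1 (EuclideanSpace.single j.2 1)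

theorem sum_coord_smul_polyBasis {N : ℕ} {l : Fin N → ℕ} (z : PolySpace l) :
    ∑ j : Σ i, Fin (l i), (z j.1 j.2) • polyBasis l j = z := by
  rw [Fintype.sum_sigma]
  funext i
  rw [Finset.sum_apply, Finset.sum_eq_single i]
  · ext k
    simp [polyBasis, Pi.single_apply]
  · intro b _ hb
    simp [polyBasis, hb.symm]
  · simp

theorem isOpen_preimage_smul_polyBall {N : ℕ} {l : Fin N → ℕ} (w : PolySpace l) :
    IsOpen ((fun ζ : ℂ => ζ • w) ⁻¹' polyBall l) :=
  (isOpen_polyBall l).preimage (by fun_prop)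

theorem zero_mem_polyBall {N : ℕ} (l : Fin N → ℕ) : (0 : PolySpace l) ∈ polyBall l :=
  fun i => by simp

theorem differentiableOn_slice {N : ℕ} {l : Fin N → ℕ} {f : PolySpace l → ℂ}
    (hf : DifferentiableOn ℂ f (polyBall l)) (w : PolySpace l) :
    DifferentiableOn ℂ (fun ζ : ℂ => f (ζ • w)) ((fun ζ : ℂ => ζ • w) ⁻¹' polyBall l) :=
  hf.comp (by fun_prop) fun _ h => h

theorem contDiffAt_slice {N : ℕ} {l : Fin N → ℕ} {f : PolySpace l → ℂ}
    (hf : DifferentiableOn ℂ f (polyBall l)) (w : PolySpace l) (m : ℕ) :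
    ContDiffAt ℂ m (fun ζ : ℂ => f (ζ • w)) 0 :=
  ((differentiableOn_slice hf w).contDiffOn (isOpen_preimage_smul_polyBall w)).contDiffAt
    ((isOpen_preimage_smul_polyBall w).mem_nhds (by
      rw [mem_preimage, zero_smul]; exact zero_mem_polyBall l))

/-- The derivatives at the origin along complex lines are homogeneous polynomials. -/
theorem iteratedDeriv_slice_mem_homogPoly {N : ℕ} {l : Fin N → ℕ} (m : ℕ) :
    ∀ f : PolySpace l → ℂ, DifferentiableOn ℂ f (polyBall l) →
      (fun w => iteratedDeriv m (fun ζ : ℂ => f (ζ • w)) 0) ∈ homogPoly l m := by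
  induction m with
  | zero =>
    intro f _
    have : (fun w : PolySpace l => iteratedDeriv 0 (fun ζ : ℂ => f (ζ • w)) 0) =
        f 0 • polyMonomial (0 : (Σ i, Fin (l i)) → ℕ) := by
      funext w; simp [polyMonomial]
    rw [this]
    exact Submodule.smul_mem _ _ (Submodule.subset_span ⟨0, by simp, rfl⟩)
  | succ m ih =>
    intro f hf
    have hdj : ∀ j : Σ i, Fin (l i),
        DifferentiableOn ℂ (fun z => fderiv ℂ f z (polyBasis l j)) (polyBall l) := fun j =>
      differentiableOn_fderiv_apply_const (isOpen_polyBall l) hf (polyBasis l j)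
    -- By the chain rule, one derivative along `ζ ↦ ζ • w` is `∑ w_j ∂_j f`; each `∂_j f` is again
    -- holomorphic, and the factor `w_j` raises the degree by one.
    have heq : (fun w : PolySpace l => iteratedDeriv (m + 1) (fun ζ : ℂ => f (ζ • w)) 0) =
        ∑ j : Σ i, Fin (l i), fun w : PolySpace l => w j.1 j.2 *
          iteratedDeriv m (fun ζ : ℂ => fderiv ℂ f (ζ • w) (polyBasis l j)) 0 := by
      funext w
      have h1 : deriv (fun ζ : ℂ => f (ζ • w)) =ᶠ[𝓝 0]
          fun ζ => ∑ j : Σ i, Fin (l i), w j.1 j.2 * fderiv ℂ f (ζ • w) (polyBasis l j) := by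
        filter_upwards [(isOpen_preimage_smul_polyBall w).mem_nhds (by
          rw [mem_preimage, zero_smul]; exact zero_mem_polyBall l : (0 : ℂ) ∈ _)] with ζ hζ
        have hl : HasDerivAt (fun ζ : ℂ => ζ • w) w ζ := by
          simpa using (hasDerivAt_id ζ).smul_const w
        have hfz := (hf.differentiableAt ((isOpen_polyBall l).mem_nhds hζ)).hasFDerivAt
        refine (hfz.comp_hasDerivAt ζ hl).deriv.trans ?_
        have := congrArg (fderiv ℂ f (ζ • w)) (sum_coord_smul_polyBasis w).symm
        simpa only [map_sum, map_smul, smul_eq_mul] using this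
      rw [iteratedDeriv_succ', h1.iteratedDeriv_eq, Finset.sum_apply]
      rw [iteratedDeriv_fun_sum fun j _ => contDiffAt_const.mul (contDiffAt_slice (hdj j) w m)]
      refine Finset.sum_congr rfl fun j _ => ?_
      exact iteratedDeriv_const_mul_field _ _
    rw [heq]
    exact Submodule.sum_mem _ fun j _ => coord_mul_mem_homogPoly (ih _ (hdj j)) j

/-- The Taylor polynomial of degree `< K` at the origin. -/
def taylorSum {N : ℕ} {l : Fin N → ℕ} (K : ℕ) (f : PolySpace l → ℂ) (w : PolySpace l) : ℂ :=
  ∑ m ∈ Finset.range K, (m.factorial : ℂ)⁻¹ * iteratedDeriv m (fun ζ : ℂ => f (ζ • w)) 0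

/-- The polynomials of degree `< K` in each coordinate. -/
def truncPoly {N : ℕ} (l : Fin N → ℕ) (K : ℕ) : Submodule ℂ (PolySpace l → ℂ) :=
  Submodule.span ℂ (range fun α : (Σ i, Fin (l i)) → Fin K => polyMonomial fun j => (α j : ℕ))

/-- Bounding each exponent separately, rather than the total degree, makes the count of monomials
exactly a power of `K`. -/
theorem rank_truncPoly_le {N : ℕ} (l : Fin N → ℕ) (K : ℕ) :
    Module.rank ℂ (truncPoly l K) ≤ ((K ^ ∑ i, l i : ℕ) : Cardinal) := by
  refine (rank_span_le _).trans (Cardinal.mk_range_le.trans ?_)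
  rw [Cardinal.mk_fintype]
  simp

theorem homogPoly_le_truncPoly {N : ℕ} (l : Fin N → ℕ) {m K : ℕ} (h : m < K) :
    homogPoly l m ≤ truncPoly l K := by
  refine Submodule.span_le.2 ?_
  rintro _ ⟨α, hα, rfl⟩
  refine Submodule.subset_span ⟨fun j => ⟨α j, lt_of_le_of_lt ?_ h⟩, rfl⟩
  rw [← hα]
  exact Finset.single_le_sum (fun _ _ => Nat.zero_le _) (Finset.mem_univ j)

theorem taylorSum_mem_truncPoly {N : ℕ} {l : Fin N → ℕ} (K : ℕ) {f : PolySpace l → ℂ}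
    (hf : DifferentiableOn ℂ f (polyBall l)) : taylorSum K f ∈ truncPoly l K := by
  have : taylorSum K f = ∑ m ∈ Finset.range K, (m.factorial : ℂ)⁻¹ •
      fun w : PolySpace l => iteratedDeriv m (fun ζ : ℂ => f (ζ • w)) 0 := by
    funext w; simp [taylorSum]
  rw [this]
  exact Submodule.sum_mem _ fun m hm => Submodule.smul_mem _ _
    (homogPoly_le_truncPoly l (Finset.mem_range.1 hm) (iteratedDeriv_slice_mem_homogPoly m f hf))

theorem taylorSum_add {N : ℕ} {l : Fin N → ℕ} (K : ℕ) {f g : PolySpace l → ℂ}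
    (hf : DifferentiableOn ℂ f (polyBall l)) (hg : DifferentiableOn ℂ g (polyBall l)) :
    taylorSum K (f + g) = taylorSum K f + taylorSum K g := by
  funext w
  simp only [taylorSum, Pi.add_apply, ← Finset.sum_add_distrib, ← mul_add]
  refine Finset.sum_congr rfl fun m _ => ?_
  rw [iteratedDeriv_fun_add (contDiffAt_slice hf w m) (contDiffAt_slice hg w m)]

theorem taylorSum_smul {N : ℕ} {l : Fin N → ℕ} (K : ℕ) (c : ℂ) (f : PolySpace l → ℂ) :
    taylorSum K (c • f) = c • taylorSum K f := by
  funext w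
  simp only [taylorSum, Pi.smul_apply, smul_eq_mul, Finset.mul_sum]
  refine Finset.sum_congr rfl fun m _ => ?_
  rw [iteratedDeriv_const_mul_field]
  ring

theorem differentiable_of_mem_truncPoly {N : ℕ} {l : Fin N → ℕ} {K : ℕ} {p : PolySpace l → ℂ}
    (hp : p ∈ truncPoly l K) : Differentiable ℂ p := by
  induction hp using Submodule.span_induction with
  | mem p hp =>
    obtain ⟨α, rfl⟩ := hp
    unfold polyMonomial
    fun_prop
  | zero => exact differentiable_const 0
  | add p q _ _ hp hq => exact hp.add hq
  | smul c p _ hp => exact hp.const_smul c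

/-! ### Cauchy estimates and the Taylor remainder -/

/-- Cauchy's estimates for the homogeneous terms of the Taylor expansion. -/
theorem norm_taylor_term_le {N : ℕ} {l : Fin N → ℕ} {f : PolySpace l → ℂ}
    (hf : DifferentiableOn ℂ f (polyBall l)) {ρ r M : ℝ} (hρ : 0 < ρ) (hρr : ρ < r) (hr : r < 1)
    (hM : ∀ z : PolySpace l, (∀ i, ‖z i‖ ≤ r) → ‖f z‖ ≤ M) {w : PolySpace l}
    (hw : ∀ i, ‖w i‖ ≤ ρ) (m : ℕ) :
    ‖(m.factorial : ℂ)⁻¹ * iteratedDeriv m (fun ζ : ℂ => f (ζ • w)) 0‖ ≤ M * (ρ / r) ^ m := by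
  have hr0 : 0 < r := hρ.trans hρr
  -- On the disc `‖ζ‖ ≤ r / ρ` the point `ζ • w` stays where `f` is bounded by `M`.
  have hR : 0 < r / ρ := by positivity
  have hin : ∀ ζ : ℂ, ‖ζ‖ ≤ r / ρ → ∀ i, ‖(ζ • w) i‖ ≤ r := fun ζ hζ i => by
    rw [Pi.smul_apply, norm_smul]
    calc ‖ζ‖ * ‖w i‖ ≤ r / ρ * ρ := by gcongr; exact hw i
      _ = r := by field_simp
  have hd : DiffContOnCl ℂ (fun ζ : ℂ => f (ζ • w)) (Metric.ball 0 (r / ρ)) := by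
    apply DifferentiableOn.diffContOnCl
    rw [closure_ball _ hR.ne']
    refine (differentiableOn_slice hf w).mono fun ζ hζ i => ?_
    exact (hin ζ (by simpa using hζ) i).trans_lt hr
  have := Complex.norm_iteratedDeriv_le_of_forall_mem_sphere_norm_le m hR hd (C := M)
    fun ζ hζ => hM _ (hin ζ (by simpa using (mem_sphere_zero_iff_norm.1 hζ).le))
  have hm : (0 : ℝ) < m.factorial := by exact_mod_cast m.factorial_pos
  rw [norm_mul, norm_inv, Complex.norm_natCast, inv_mul_le_iff₀ hm]
  refine this.trans_eq ?_
  rw [div_pow, div_pow]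
  field_simp

theorem norm_taylorSum_sub_le {N : ℕ} {l : Fin N → ℕ} {f : PolySpace l → ℂ}
    (hf : DifferentiableOn ℂ f (polyBall l)) {ρ r M : ℝ} (hρ : 0 < ρ) (hρr : ρ < r) (hr : r < 1)
    (hM : ∀ z : PolySpace l, (∀ i, ‖z i‖ ≤ r) → ‖f z‖ ≤ M) {w : PolySpace l}
    (hw : ∀ i, ‖w i‖ ≤ ρ) (K : ℕ) :
    ‖taylorSum K f w - f w‖ ≤ M * (ρ / r) ^ K / (1 - ρ / r) := by
  have hr0 : 0 < r := hρ.trans hρr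
  have hd : DifferentiableOn ℂ (fun ζ : ℂ => f (ζ • w)) (Metric.ball 0 (1 / ρ)) := by
    refine (differentiableOn_slice hf w).mono fun ζ hζ i => ?_
    rw [mem_ball_zero_iff, lt_div_iff₀ hρ] at hζ
    change ‖ζ • w i‖ < 1
    rw [norm_smul]
    exact (mul_le_mul_of_nonneg_left (hw i) (norm_nonneg ζ)).trans_lt hζ
  -- The slice is holomorphic on a disc of radius `1 / ρ > 1`, so its Taylor series may be summed at
  -- `ζ = 1`, where it gives `f w`.
  have h1 : (1 : ℂ) ∈ Metric.ball (0 : ℂ) (1 / ρ) := by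
    rw [mem_ball_zero_iff, norm_one, lt_div_iff₀ hρ]; linarith
  have hsum := Complex.hasSum_taylorSeries_on_ball hd h1
  simp only [sub_zero, one_pow, one_smul, smul_eq_mul, one_mul] at hsum
  exact norm_sub_le_of_geometric_bound_of_hasSum ((div_lt_one hr0).2 hρr)
    (fun m => norm_taylor_term_le hf hρ hρr hr hM hw m) hsum K

/-! ### Finite-rank approximation of the composition operator -/

theorem Hardy.add_apply {N : ℕ} {l : Fin N → ℕ} (f g : Hardy l) (z : PolySpace l) :
    (f + g) z = f z + g z := rfl

theorem Hardy.sub_apply {N : ℕ} {l : Fin N → ℕ} (f g : Hardy l) (z : PolySpace l) :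
    (f - g) z = f z - g z := rfl

theorem Hardy.smul_apply {N : ℕ} {l : Fin N → ℕ} (c : ℂ) (f : Hardy l) (z : PolySpace l) :
    (c • f) z = c * f z := rfl

theorem Hardy.norm_le_of_forall_norm_le {N : ℕ} {l : Fin N → ℕ} [∀ i, NeZero (l i)] {f : Hardy l}
    {M : ℝ} (hM0 : 0 ≤ M) (hf : ∀ z ∈ polyBall l, ‖f z‖ ≤ M) : ‖f‖ ≤ M :=
  ENNReal.toReal_le_of_le_ofReal hM0 (hardyENorm_le_of_forall_norm_le hf)

/-- A bounded holomorphic function on `Ω`, as an element of `H²(Ω)`. -/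
def Hardy.ofBounded {N : ℕ} {l : Fin N → ℕ} [∀ i, NeZero (l i)] (g : PolySpace l → ℂ)
    (hg : DifferentiableOn ℂ g (polyBall l)) (hb : ∃ M : ℝ, ∀ z ∈ polyBall l, ‖g z‖ ≤ M) :
    Hardy l :=
  ⟨(polyBall l).indicator g, hg.congr fun z hz => indicator_of_mem hz g,
    fun z hz => indicator_of_notMem hz g, by
      obtain ⟨M, hM⟩ := hb
      refine (hardyENorm_le_of_forall_norm_le (M := M) fun z hz => ?_).trans_lt
        ENNReal.ofReal_lt_top
      rw [indicator_of_mem hz]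
      exact hM z hz⟩

theorem Hardy.ofBounded_apply {N : ℕ} {l : Fin N → ℕ} [∀ i, NeZero (l i)] {g : PolySpace l → ℂ}
    (hg : DifferentiableOn ℂ g (polyBall l)) (hb : ∃ M : ℝ, ∀ z ∈ polyBall l, ‖g z‖ ≤ M)
    {z : PolySpace l} (hz : z ∈ polyBall l) : Hardy.ofBounded g hg hb z = g z :=
  indicator_of_mem hz g

theorem Hardy.ext_on {N : ℕ} {l : Fin N → ℕ} {f g : Hardy l}
    (h : ∀ z ∈ polyBall l, f z = g z) : f = g :=
  Subtype.ext <| funext fun z => by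
    by_cases hz : z ∈ polyBall l
    · exact h z hz
    · exact (f.2.2.1 z hz).trans (g.2.2.1 z hz).symm

theorem norm_taylorSum_le {N : ℕ} {l : Fin N → ℕ} {f : PolySpace l → ℂ}
    (hf : DifferentiableOn ℂ f (polyBall l)) {ρ r M : ℝ} (hρ : 0 < ρ) (hρr : ρ < r) (hr : r < 1)
    (hM : ∀ z : PolySpace l, (∀ i, ‖z i‖ ≤ r) → ‖f z‖ ≤ M) {w : PolySpace l}
    (hw : ∀ i, ‖w i‖ ≤ ρ) (K : ℕ) :
    ‖taylorSum K f w‖ ≤ M * (ρ / r) ^ K / (1 - ρ / r) + M := by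
  have h1 := norm_taylorSum_sub_le hf hρ hρr hr hM hw K
  have h2 := hM w fun i => (hw i).trans hρr.le
  calc ‖taylorSum K f w‖ = ‖(taylorSum K f w - f w) + f w‖ := by rw [sub_add_cancel]
    _ ≤ _ := (norm_add_le _ _).trans (add_le_add h1 h2)

/-- A composition operator whose symbol maps `Ω` into a smaller dilate of `Ω` is approximated at
a geometric rate by the operators `f ↦ p_K ∘ φ`, where `p_K` is the Taylor polynomial of `f`. -/
theorem exists_finiteRank_approx {N : ℕ} {l : Fin N → ℕ} [∀ i, NeZero (l i)]
    {φ : PolySpace l → PolySpace l} (hφ : DifferentiableOn ℂ φ (polyBall l)) {ρ : ℝ} (hρ : 0 < ρ)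
    (hρ1 : ρ < 1) (hφρ : ∀ z ∈ polyBall l, ∀ i, ‖φ z i‖ ≤ ρ) {T : Hardy l →L[ℂ] Hardy l}
    (hT : IsCompositionOperator l φ T) :
    ∃ q C : ℝ, 0 < q ∧ q < 1 ∧ 0 ≤ C ∧ ∀ K : ℕ, ∃ R : Hardy l →L[ℂ] Hardy l,
      R.toLinearMap.rank ≤ ((K ^ ∑ i, l i : ℕ) : Cardinal) ∧ ‖T - R‖ ≤ C * q ^ K := by
  obtain ⟨r, hρr, hr⟩ := exists_between hρ1
  have hr0 : 0 < r := hρ.trans hρr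
  obtain ⟨C, hC0, hC⟩ := Hardy.exists_norm_apply_le l hr0.le hr
  have hq1 : ρ / r < 1 := (div_lt_one hr0).2 hρr
  have h1q : 0 < 1 - ρ / r := by linarith
  refine ⟨ρ / r, C / (1 - ρ / r), by positivity, hq1, by positivity, fun K => ?_⟩
  have hbd : ∀ f : Hardy l, ∀ z ∈ polyBall l, ‖taylorSum K f (φ z)‖ ≤
      (C * (ρ / r) ^ K / (1 - ρ / r) + C) * ‖f‖ := fun f z hz =>
    (norm_taylorSum_le f.differentiableOn hρ hρr hr (hC f) (hφρ z hz) K).trans_eq (by ring)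
  let A : Hardy l →ₗ[ℂ] Hardy l :=
    { toFun := fun f => Hardy.ofBounded (fun z => taylorSum K f (φ z))
        ((differentiable_of_mem_truncPoly
          (taylorSum_mem_truncPoly K f.differentiableOn)).comp_differentiableOn hφ)
        ⟨_, hbd f⟩
      map_add' := fun f g => Hardy.ext_on fun z hz => by
        rw [Hardy.add_apply, Hardy.ofBounded_apply _ _ hz, Hardy.ofBounded_apply _ _ hz,
          Hardy.ofBounded_apply _ _ hz]
        exact congrFun (taylorSum_add K f.differentiableOn g.differentiableOn) (φ z)
      map_smul' := fun c f => Hardy.ext_on fun z hz => by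
        rw [RingHom.id_apply, Hardy.smul_apply, Hardy.ofBounded_apply _ _ hz,
          Hardy.ofBounded_apply _ _ hz]
        exact congrFun (taylorSum_smul K c f) (φ z) }
  have hA : ∀ f : Hardy l, ∀ z ∈ polyBall l, A f z = taylorSum K f (φ z) := fun f z hz =>
    indicator_of_mem hz fun z => taylorSum K f (φ z)
  let R : Hardy l →L[ℂ] Hardy l := A.mkContinuous (C * (ρ / r) ^ K / (1 - ρ / r) + C) fun f =>
    Hardy.norm_le_of_forall_norm_le (by positivity) fun z hz => by
      rw [hA f z hz]; exact hbd f z hz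
  refine ⟨R, ?_, ?_⟩
  -- The range of `A`, viewed as functions, lies in the image of `truncPoly l K` under composition
  -- with `φ`. The indicator matches the extension by zero used for elements of `Hardy l`.
  · let Φ : (PolySpace l → ℂ) →ₗ[ℂ] (PolySpace l → ℂ) :=
      { toFun := fun p => (polyBall l).indicator (p ∘ φ)
        map_add' := fun p q => indicator_add _ _ _
        map_smul' := fun c p => indicator_const_smul (polyBall l) c (p ∘ φ) }
    let ι : Hardy l →ₗ[ℂ] (PolySpace l → ℂ) := (hardySubmodule l).subtype
    have hι : Function.Injective ι := Subtype.val_injective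
    have hle : (LinearMap.range A).map ι ≤ (truncPoly l K).map Φ := by
      rintro _ ⟨_, ⟨f, rfl⟩, rfl⟩
      exact ⟨taylorSum K f, taylorSum_mem_truncPoly K f.differentiableOn, rfl⟩
    calc R.toLinearMap.rank = Module.rank ℂ ((LinearMap.range A).map ι) :=
          (Submodule.equivMapOfInjective ι hι (LinearMap.range A)).rank_eq
      _ ≤ Module.rank ℂ ((truncPoly l K).map Φ) := Submodule.rank_mono hle
      _ ≤ Module.rank ℂ (truncPoly l K) := rank_map_le _ _
      _ ≤ _ := rank_truncPoly_le l K
  · refine ContinuousLinearMap.opNorm_le_bound _ (by positivity) fun f => ?_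
    refine Hardy.norm_le_of_forall_norm_le (by positivity) fun z hz => ?_
    have h1 : (T - R) f z = f (φ z) - taylorSum K f (φ z) := by
      rw [← hT f z hz, ← hA f z hz]
      exact Hardy.sub_apply (T f) (A f) z
    rw [h1, norm_sub_rev]
    exact (norm_taylorSum_sub_le f.differentiableOn hρ hρr hr (hC f) (hφρ z hz) K).trans_eq
      (by ring)

/-! ### Decay of approximation numbers -/

theorem approxNumber_le_norm_sub {H : Type*} [NormedAddCommGroup H] [NormedSpace ℂ H]
    (T R : H →L[ℂ] H) {n : ℕ} (hR : R.toLinearMap.rank < (n : Cardinal)) :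
    approxNumber T n ≤ ‖T - R‖ :=
  csInf_le ⟨0, by rintro _ ⟨R, _, rfl⟩; exact norm_nonneg _⟩ ⟨R, hR, rfl⟩

/-- Approximation at a geometric rate by operators of rank at most `K^d` makes the approximation
numbers decay like `e^{-c n^{1/d}}`. -/
theorem approxNumber_le_exp {H : Type*} [NormedAddCommGroup H] [NormedSpace ℂ H] {T : H →L[ℂ] H}
    {d : ℕ} (hd : d ≠ 0) {q C : ℝ} (hq : 0 < q) (hq1 : q < 1) (hC : 0 ≤ C)
    (h : ∀ K : ℕ, ∃ R : H →L[ℂ] H, R.toLinearMap.rank ≤ ((K ^ d : ℕ) : Cardinal) ∧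
      ‖T - R‖ ≤ C * q ^ K) {n : ℕ} (hn : 1 ≤ n) :
    approxNumber T n ≤ C / q * Real.exp (-(-Real.log q) * (n : ℝ) ^ (1 / (d : ℝ))) := by
  set x : ℝ := (n : ℝ) ^ (1 / (d : ℝ)) with hx
  have hx0 : 0 < x := Real.rpow_pos_of_pos (by exact_mod_cast hn) _
  have hxd : x ^ d = n := by
    rw [hx, one_div, Real.rpow_inv_natCast_pow (Nat.cast_nonneg n) hd]
  -- The largest integer strictly below `x`: strictness gives `K ^ d < n`, as `rank R < n` demands,
  -- while `K ≥ x - 1` costs only the factor `1 / q`.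
  set K := ⌈x⌉₊ - 1 with hK
  have hceil : 1 ≤ ⌈x⌉₊ := Nat.one_le_iff_ne_zero.2 (Nat.ceil_pos.2 hx0).ne'
  have hKc : ((K : ℕ) : ℝ) = ⌈x⌉₊ - 1 := by rw [hK, Nat.cast_sub hceil, Nat.cast_one]
  have hK1 : (K : ℝ) < x := by rw [hKc]; linarith [Nat.ceil_lt_add_one hx0.le]
  have hK2 : x - 1 ≤ K := by rw [hKc]; linarith [Nat.le_ceil x]
  have hKn : K ^ d < n := by
    have : (K : ℝ) ^ d < n := by
      rw [← hxd]; exact pow_lt_pow_left₀ hK1 (Nat.cast_nonneg K) hd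
    exact_mod_cast this
  obtain ⟨R, hR, hTR⟩ := h K
  refine (approxNumber_le_norm_sub T R (hR.trans_lt (by exact_mod_cast hKn))).trans
    (hTR.trans ?_)
  have hlog : Real.log q < 0 := Real.log_neg hq hq1
  have h1 : q ^ K ≤ q⁻¹ * Real.exp (Real.log q * x) := by
    have h2 : q ^ K = Real.exp (Real.log q * K) := by
      rw [mul_comm, Real.exp_nat_mul, Real.exp_log hq]
    have h3 : q⁻¹ = Real.exp (-Real.log q) := by rw [Real.exp_neg, Real.exp_log hq]
    rw [h2, h3, ← Real.exp_add, Real.exp_le_exp]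
    nlinarith
  rw [neg_neg, div_eq_mul_inv, mul_assoc]
  exact mul_le_mul_of_nonneg_left h1 hC

theorem gammaMinus_pos_of_le_exp {H : Type*} [NormedAddCommGroup H] [NormedSpace ℂ H]
    {T : H →L[ℂ] H} {d : ℕ} (hd : d ≠ 0) {c C : ℝ} (hc : 0 < c)
    (h : ∀ n : ℕ, 1 ≤ n → approxNumber T n ≤ C * Real.exp (-c * (n : ℝ) ^ (1 / (d : ℝ)))) :
    0 < gammaMinus d T := by
  have hlim : Tendsto (fun n : ℕ => (n : ℝ) ^ (1 / (d : ℝ))) atTop atTop :=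
    (tendsto_rpow_atTop (by positivity)).comp tendsto_natCast_atTop_atTop
  -- Half of the exponent is spent absorbing `C`; the other half bounds the liminf from below.
  have hexp : ∀ᶠ n : ℕ in atTop, C ≤ Real.exp (c / 2 * (n : ℝ) ^ (1 / (d : ℝ))) :=
    (Real.tendsto_exp_atTop.comp (hlim.const_mul_atTop (by positivity))).eventually_ge_atTop C
  have hc2 : (0 : EReal) < ((c / 2 : ℝ) : EReal) := by exact_mod_cast half_pos hc
  refine hc2.trans_le (le_liminf_of_le (by isBoundedDefault) ?_)
  filter_upwards [hexp, eventually_ge_atTop 1, hlim.eventually_gt_atTop 0] with n h1 h2 hx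
  set x : ℝ := (n : ℝ) ^ (1 / (d : ℝ))
  have h3 : approxNumber T n ≤ Real.exp (-(c / 2 * x)) := by
    refine (h n h2).trans ?_
    calc C * Real.exp (-c * x) ≤ Real.exp (c / 2 * x) * Real.exp (-c * x) := by gcongr
      _ = Real.exp (-(c / 2 * x)) := by rw [← Real.exp_add]; ring_nf
  rw [EReal.le_div_iff_mul_le (by exact_mod_cast hx) (EReal.coe_ne_top _)]
  -- Inverting in `ℝ≥0∞` covers the case `a_n = 0` without a separate argument.
  have h4 : ENNReal.ofReal (Real.exp (c / 2 * x)) ≤ (ENNReal.ofReal (approxNumber T n))⁻¹ := by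
    rw [ENNReal.le_inv_iff_le_inv, ← ENNReal.ofReal_inv_of_pos (Real.exp_pos _), ← Real.exp_neg]
    exact ENNReal.ofReal_le_ofReal h3
  calc ((c / 2 : ℝ) : EReal) * (x : EReal) = ((c / 2 * x : ℝ) : EReal) := by norm_cast
    _ = ENNReal.log (ENNReal.ofReal (Real.exp (c / 2 * x))) := by
      rw [ENNReal.log_ofReal_of_pos (Real.exp_pos _), Real.log_exp]
    _ ≤ _ := ENNReal.log_monotone h4

theorem norm_apply_le_supNorm {N : ℕ} {l : Fin N → ℕ} {φ : PolySpace l → PolySpace l}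
    (hφ : MapsTo φ (polyBall l) (polyBall l)) {z : PolySpace l} (hz : z ∈ polyBall l) :
    ‖φ z‖ ≤ supNorm l φ := by
  refine le_csSup ⟨1, ?_⟩ (mem_image_of_mem _ hz)
  rintro _ ⟨w, hw, rfl⟩
  exact (pi_norm_le_iff_of_nonneg zero_le_one).2 fun i => (hφ hw i).le

theorem mainTheorem2 {N : ℕ} (l : Fin N → ℕ) [∀ i, NeZero (l i)] (d : ℕ) (hd : d = ∑ i, l i)
    (φ : PolySpace l → PolySpace l) (hφ : IsSchurMap l φ) (hφd : IsTrulyDimensional l φ)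
    (T : Hardy l →L[ℂ] Hardy l) (hT : IsCompositionOperator l φ T) (hTc : IsCompactOperator T)
    (hsup : supNorm l φ < 1) :
    0 < gammaMinus d T ∧
      ∃ c C : ℝ, 0 < c ∧ c ≤ C ∧ ∀ n : ℕ, 1 ≤ n →
        approxNumber T n ≤ C * Real.exp (-c * (n : ℝ) ^ (1 / (d : ℝ))) := by
  -- A non-constant map forces at least one factor, and each factor has positive dimension.
  have hd0 : d ≠ 0 := by
    obtain ⟨z, _, w, _, hzw⟩ := hφ.nonconstant
    obtain ⟨i, _⟩ : ∃ i, φ z i ≠ φ w i := Function.ne_iff.1 hzw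
    have h1 : l i ≤ ∑ i, l i := Finset.single_le_sum (fun _ _ => Nat.zero_le _) (Finset.mem_univ i)
    have h2 : l i ≠ 0 := NeZero.ne _
    omega
  -- The maximum with `0` makes `ρ` positive, as the radii `r / ρ` and `1 / ρ` require.
  obtain ⟨ρ, hρ, hρ1⟩ := exists_between (max_lt hsup zero_lt_one)
  have hφρ : ∀ z ∈ polyBall l, ∀ i, ‖φ z i‖ ≤ ρ := fun z hz i =>
    (norm_le_pi_norm _ i).trans ((norm_apply_le_supNorm hφ.mapsTo hz).trans
      ((le_max_left _ _).trans hρ.le))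
  obtain ⟨q, C, hq, hq1, hC, hR⟩ := exists_finiteRank_approx hφ.differentiableOn
    ((le_max_right _ _).trans_lt hρ) hρ1 hφρ hT
  rw [← hd] at hR
  -- Enlarging the constant to the maximum secures `c ≤ C` with `c = -log q`.
  have hbound : ∀ n : ℕ, 1 ≤ n → approxNumber T n ≤
      max (C / q) (-Real.log q) * Real.exp (-(-Real.log q) * (n : ℝ) ^ (1 / (d : ℝ))) :=
    fun n hn => (approxNumber_le_exp hd0 hq hq1 hC hR hn).trans
      (mul_le_mul_of_nonneg_right (le_max_left _ _) (Real.exp_pos _).le)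
  have hlog : 0 < -Real.log q := neg_pos.2 (Real.log_neg hq hq1)
  exact ⟨gammaMinus_pos_of_le_exp hd0 hlog hbound, -Real.log q, _, hlog, le_max_right _ _, hbound⟩

end
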